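/- Let $G=(V,E)$ be a nonempty finite simple undirected graph without isolated vertices, with $n$ vertices, $m$ edges and degeneracy $d$ (the largest minimum degree of a nonempty subgraph). Write $N(v)$ for the open and $N[v]$ for the closed neighbourhood of $v$. A *clique cover* of $G$ is a family $\mathcal C=\{C_\ell\}_{\ell\in I}$ of cliques of $G$ such that every edge lies in some $C_\ell$. A *dual clique cover (DCC) representation* of $G$ is a pair $(\mathcal C,\mathcal L)$ of a clique cover $\mathcal C$ and its incidence dual $\mathcal L=\{L_v\}_{v\in V}$, $L_v=\{\ell\in I: v\in C_\ell\}$, with $\bigcup_v L_v=I$. It is *succinct* if no two or more members of $\mathcal C$ have a union that is a clique of $G$ and $\sum_{\ell\in I}|C_\ell|=O(m)$. The algorithm *Global-Admissibility* maintains label sets $L_v, A_v$ ($v\in V$) and, for every label $\ell$ in use, vertex sets $C_\ell, D_\ell$. It starts with no labels and $L_v=A_v=\emptyset$. It goes through the edges $\{u,v\}\in E$ in an arbitrary order, and for each edge with $L_u\cap L_v=\emptyset$ at that moment it does the following. 1. If $A_u\cap A_v\neq\emptyset$: select an arbitrary label $\ell\in A_u\cap A_v$, add $\ell$ to $L_u$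 and $L_v$, and add $u,v$ to $C_\ell$; let $X$ be the set of $w\in D_\ell\setminus C_\ell$ that are non-adjacent to $u$ or to $v$; remove $X$ from $D_\ell$, and remove $\ell$ from $A_w$ for all $w\in X$. 2. Otherwise: introduce a new label $\ell$ with $C_\ell=\{u,v\}$, add $\ell$ to $L_u$ and $L_v$, let $D_\ell=N[u]\cap N[v]$, and add $\ell$ to $A_w$ for all $w\in D_\ell$. It returns $(\mathcal C,\mathcal L)$ with $\mathcal C=\{C_\ell\}$ and $\mathcal L=\{L_v\}$. The input graph is available as the sets $N(v)$ and a list of the edges. An intersection is computed by scanning the smaller set and testing its elements for membership in the larger one; membership tests, insertions and deletions in a set of $k$ elements, and moving to its next element in a scan, are elementary operations that take time $\lfloor\log_2 k\rfloor+1$ (time $1$ if $k=0$). Space is the largest number of words in use at any moment, the input not counted: one word per element of a stored set, one word for each of the sets $L_v,A_v,C_\ell,D_\ell$, and a constant number of registers. Then, for every order of the edges and all selections of labels, Global-Admissibility returns a succinct DCC representation $(\mathcal C,\mathcal L)$ of $G$. It performs $O(\min\{|\mathcal C|\,n^2,\ d^2m\})$ elementary operations, and thus runs in time $O(\min\{|\mathcal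 C|\,n^2,\ d^2m\})$ up to a logarithmic factor, namely $O(\min\{|\mathcal C|\,n^2,\ d^2m\}\cdot(1+\log n))$; and it uses $O(\min\{|\mathcal C|\,n,\ dm\})$ space. The constants are absolute: they do not depend on $G$, on the order of the edges, or on the selections. -/

import Mathlib

namespace GlobalAdm

universe u v

/-! ### Clique covers and dual clique cover representations -/

/-- A pair `(𝒞, ℒ)`: a family `𝒞 = {C ℓ}` of vertex sets indexed by the labels `ℓ ∈ I`, and a
family `ℒ = {L v}` of label sets indexed by the vertices. The values of `C` outside `I` are
irrelevant. -/
structure Rep (V : Type u) where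
  I : Finset ℕ
  C : ℕ → Finset V
  L : V → Finset ℕ

/-- `{C ℓ}_{ℓ ∈ I}` is a clique cover of `G`: every member is a clique, and every edge lies in
some member. -/
def IsCliqueCover {V : Type u} (G : SimpleGraph V) (I : Finset ℕ) (C : ℕ → Finset V) : Prop :=
  (∀ ℓ ∈ I, G.IsClique (C ℓ : Set V)) ∧ ∀ x y, G.Adj x y → ∃ ℓ ∈ I, x ∈ C ℓ ∧ y ∈ C ℓ

/-- No two or more members of the family have a union that is a clique of `G`. -/
def IsCompositionMinimal {V : Type u} (G : SimpleGraph V) (I : Finset ℕ)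
    (C : ℕ → Finset V) : Prop :=
  ∀ J ⊆ I, 2 ≤ J.card → ¬ G.IsClique (⋃ ℓ ∈ J, (C ℓ : Set V))

/-- `(𝒞, ℒ)` is a dual clique cover representation of `G`: `𝒞` is a clique cover and `ℒ` is its
incidence dual. -/
def IsDCC {V : Type u} [Fintype V] [DecidableEq V] (G : SimpleGraph V) (R : Rep V) : Prop :=
  IsCliqueCover G R.I R.C ∧ (∀ v, R.L v = R.I.filter fun ℓ => v ∈ R.C ℓ) ∧
    Finset.univ.biUnion R.L = R.I

/-- A DCC representation that is composition-minimal and whose total clique size is at most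
`K · m`. Succinctness (`O(m)`) is this property with one `K` for all graphs. -/
def IsSuccinctDCC {V : Type u} [Fintype V] [DecidableEq V] (K : ℕ) (G : SimpleGraph V)
    [DecidableRel G.Adj] (R : Rep V) : Prop :=
  IsDCC G R ∧ IsCompositionMinimal G R.I R.C ∧ ∑ ℓ ∈ R.I, (R.C ℓ).card ≤ K * G.edgeFinset.card

/-- The degeneracy of `G`: the largest minimum degree of a (nonempty) subgraph. -/
noncomputable def degeneracy {V : Type u} (G : SimpleGraph V) : ℕ :=
  sSup {k | ∃ H : G.Subgraph, H.verts.Nonempty ∧ ∀ x ∈ H.verts, k ≤ (H.neighborSet x).ncard}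

/-! ### A machine that stores sets

The machine stores finite sets and works on them one element at a time. Every primitive is charged
twice: `steps` counts elementary operations, and `time` charges a membership test, an insertion,
a deletion or the next element of a scan in a set of `k` elements with `log₂ k + 1`. -/

/-- The memory. `N` holds the input graph as open neighbourhoods; the labels in use are
`0, …, k - 1`; `S` and `X` are scratch sets. -/
structure Memory (V : Type u) where
  N : V → Finset V
  L : V → Finset ℕ
  A : V → Finset ℕ
  C : ℕ → Finset V
  D : ℕ → Finset V
  k : ℕ
  S : Finset ℕ
  X : Finset V

/-- Number of words in use, the input `N` not counted: one word for every element of a stored set,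
one for every set `L v`, `A v`, `C ℓ`, `D ℓ`, and a constant number of scalar registers. -/
def Memory.words {V : Type u} [Fintype V] (M : Memory V) : ℕ :=
  ∑ x, ((M.L x).card + 1 + ((M.A x).card + 1)) +
    ∑ ℓ ∈ Finset.range M.k, ((M.C ℓ).card + 1 + ((M.D ℓ).card + 1)) +
    M.S.card + M.X.card + 16

/-- The memory with its counters; `peak` is the largest number of words in use so far. -/
structure Machine (V : Type u) where
  mem : Memory V
  steps : ℕ
  time : ℕ
  peak : ℕ

/-- Programs are state transformers, built only from the primitives below. -/
abbrev Prog (V : Type u) (α : Type u) := StateM (Machine V) α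

/-- A set variable of the machine: how it is read and how it is written. -/
structure SetVar (V : Type u) (β : Type v) where
  get : Memory V → Finset β
  set : Finset β → Memory V → Memory V

section Variables

variable {V : Type u} [DecidableEq V]

def vN (x : V) : SetVar V V := ⟨fun M => M.N x, fun s M => { M with N := Function.update M.N x s }⟩
def vL (x : V) : SetVar V ℕ := ⟨fun M => M.L x, fun s M => { M with L := Function.update M.L x s }⟩
def vA (x : V) : SetVar V ℕ := ⟨fun M => M.A x, fun s M => { M with A := Function.update M.A x s }⟩
def vC (ℓ : ℕ) : SetVar V V := ⟨fun M => M.C ℓ, fun s M => { M with C := Function.update M.C ℓ s }⟩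
def vD (ℓ : ℕ) : SetVar V V := ⟨fun M => M.D ℓ, fun s M => { M with D := Function.update M.D ℓ s }⟩
def vS : SetVar V ℕ := ⟨fun M => M.S, fun s M => { M with S := s }⟩
def vX : SetVar V V := ⟨fun M => M.X, fun s M => { M with X := s }⟩

end Variables

/-- Charge for one operation in a set of `k` elements. -/
def opCost (k : ℕ) : ℕ := Nat.log 2 k + 1

section Primitives

variable {V : Type u} [Fintype V] {β : Type v}

/-- Change the memory by `f` and the counters by the charges `a` and `c`. -/
def exec (a c : ℕ) (f : Memory V → Memory V) : Prog V PUnit :=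
  modify fun s => ⟨f s.mem, s.steps + a, s.time + c, max s.peak (f s.mem).words⟩

/-- Number of elements of a set. -/
def size (x : SetVar V β) : Prog V (ULift ℕ) := do
  let s ← get
  exec 1 1 id
  return ⟨(x.get s.mem).card⟩

/-- Membership test. -/
def test [DecidableEq β] (x : SetVar V β) (b : β) : Prog V (ULift Bool) := do
  let s ← get
  exec 1 (opCost (x.get s.mem).card) id
  return ⟨decide (b ∈ x.get s.mem)⟩

/-- Insertion. -/
def insert [DecidableEq β] (x : SetVar V β) (b : β) : Prog V PUnit := do
  let s ← get
  exec 1 (opCost (x.get s.mem).card) fun M => x.set (Insert.insert b (x.get M)) M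

/-- Deletion. -/
def delete [DecidableEq β] (x : SetVar V β) (b : β) : Prog V PUnit := do
  let s ← get
  exec 1 (opCost (x.get s.mem).card) fun M => x.set ((x.get M).erase b) M

/-- Emptying a set costs one step for each of its elements, and one more. -/
def clear (x : SetVar V β) : Prog V PUnit := do
  let s ← get
  exec ((x.get s.mem).card + 1) ((x.get s.mem).card + 1) fun M => x.set ∅ M

/-- Allocate a new label `ℓ`, with empty sets `C ℓ` and `D ℓ`. -/
def newLabel : Prog V (ULift ℕ) := do
  let s ← get
  exec 1 1 fun M => { M with
    k := M.k + 1, C := Function.update M.C M.k ∅, D := Function.update M.D M.k ∅ }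
  return ⟨s.mem.k⟩

/-- Select an element of a set of labels: the rule `pick` decides, and may use the number of steps
made so far (hence the whole history of the run). -/
def select (pick : ℕ → Finset ℕ → ℕ) (x : SetVar V ℕ) : Prog V (ULift ℕ) := do
  let s ← get
  exec 1 (opCost (x.get s.mem).card) id
  return ⟨pick s.steps (x.get s.mem)⟩

/-- Run `body` on the elements of a list, paying `c` to get each of them. -/
def forList (c : ℕ) (body : β → Prog V PUnit) : List β → Prog V PUnit
  | [] => pure ⟨⟩
  | b :: l => do
    exec 1 c id
    body b
    forList c body l

/-- Run `body` on the elements of a set (which `body` must not change). -/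
noncomputable def forEach (x : SetVar V β) (body : β → Prog V PUnit) : Prog V PUnit := do
  let s ← get
  forList (opCost (x.get s.mem).card) body (x.get s.mem).toList

/-- `z := x ∩ y`: scan the smaller of `x` and `y`, and test its elements for membership in the
other one. -/
noncomputable def intersect [DecidableEq β] (x y z : SetVar V β) : Prog V PUnit := do
  clear z
  let a ← size x
  let b ← size y
  if a.down ≤ b.down then
    forEach x fun e => do
      let t ← test y e
      if t.down then insert z e
  else
    forEach y fun e => do
      let t ← test x e
      if t.down then insert z e

end Primitives

/-! ### The algorithm Global-Admissibility -/

section Algorithm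

variable {V : Type u} [Fintype V] [DecidableEq V]

/-- The existing clique `C ℓ` takes in the edge `{x, y}`; then the set `X` of the vertices of
`D ℓ \ C ℓ` that are not adjacent to both `x` and `y` is computed and removed from `D ℓ`, and `ℓ` is
removed from `A w` for `w ∈ X`. -/
noncomputable def extendClique (ℓ : ℕ) (x y : V) : Prog V PUnit := do
  insert (vL x) ℓ
  insert (vL y) ℓ
  insert (vC ℓ) x
  insert (vC ℓ) y
  clear vX
  forEach (vD ℓ) fun w => do
    let c ← test (vC ℓ) w
    if !c.down then
      let a ← test (vN x) w
      let b ← test (vN y) w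
      if !(a.down && b.down) then insert vX w
  forEach vX fun w => do
    delete (vD ℓ) w
    delete (vA w) ℓ

/-- A new clique `C ℓ = {x, y}` with `D ℓ = N[x] ∩ N[y]`, which for adjacent `x`, `y` is
`(N(x) ∩ N(y)) ∪ {x, y}`; then `ℓ` is added to `A w` for `w ∈ D ℓ`. -/
noncomputable def createClique (x y : V) : Prog V PUnit := do
  let l ← newLabel
  let ℓ := l.down
  insert (vC ℓ) x
  insert (vC ℓ) y
  insert (vL x) ℓ
  insert (vL y) ℓ
  intersect (vN x) (vN y) (vD ℓ)
  insert (vD ℓ) x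
  insert (vD ℓ) y
  forEach (vD ℓ) fun w => insert (vA w) ℓ

/-- One iteration of the main loop, on the edge `{x, y}`. -/
noncomputable def processEdge (pick : ℕ → Finset ℕ → ℕ) (x y : V) : Prog V PUnit := do
  intersect (vL x) (vL y) vS
  let c ← size (vS (V := V))
  if c.down = 0 then
    intersect (vA x) (vA y) vS
    let a ← size (vS (V := V))
    if a.down ≠ 0 then
      let ℓ ← select pick (vS (V := V))
      extendClique ℓ.down x y
    else
      createClique x y

/-- The algorithm, on a graph that is given by the neighbourhoods in the memory and by the list
`edges` of its edges. -/
noncomputable def globalAdmissibility (pick : ℕ → Finset ℕ → ℕ) (edges : List (V × V)) :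
    Prog V PUnit := do
  forList 1 (fun x => do clear (vA x); clear (vL x)) (Finset.univ : Finset V).toList
  forList 1 (fun e => processEdge pick e.1 e.2) edges

/-- The memory before the run: the input graph and nothing else. -/
def inputMemory (G : SimpleGraph V) [DecidableRel G.Adj] : Memory V where
  N x := G.neighborFinset x
  L _ := ∅
  A _ := ∅
  C _ := ∅
  D _ := ∅
  k := 0
  S := ∅
  X := ∅

/-- The machine after the run on `G`. -/
noncomputable def finalMachine (G : SimpleGraph V) [DecidableRel G.Adj]
    (pick : ℕ → Finset ℕ → ℕ) (edges : List (V × V)) : Machine V :=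
  ((globalAdmissibility pick edges).run ⟨inputMemory G, 0, 0, (inputMemory G).words⟩).2

/-- The pair `(𝒞, ℒ)` that the algorithm returns. -/
def output (M : Memory V) : Rep V := ⟨Finset.range M.k, M.C, M.L⟩

end Algorithm

/-- `edges` lists every edge of `G` exactly once, each in one of its two orientations. -/
def ListsEdges {V : Type u} (G : SimpleGraph V) (edges : List (V × V)) : Prop :=
  (edges.map fun e => s(e.1, e.2)).Nodup ∧ ∀ e, e ∈ edges.map (fun e => s(e.1, e.2)) ↔ e ∈ G.edgeSet

end GlobalAdm

/-!
Correctness rests on one invariant of the main loop (`Invariant`): every `C ℓ` is a clique, `D ℓ` is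
the common closed neighbourhood of its members, and `L`, `A` are the incidence duals of `C`, `D`.
A label in `A u ∩ A v` is thus a clique to which the edge `{u, v}` can be added. If there is no such
label, then for each `ℓ` an endpoint of `{u, v}` has a non-neighbour in `C ℓ`, so the new clique can
never be merged with an older one; this property survives the growth of both, which gives
composition-minimality. Each edge adds at most two elements to the cliques.

For the costs, `orig ℓ` is the edge that introduced the label `ℓ`, and `minDeg e` is the smaller of
the degrees of the endpoints of `e`. Removing vertices of degree at most `d` one by one yields
`∑ minDeg e ≤ 2dm` and at most `d · deg x` edges inside `N(x)` (`sum_inf_map_le_degeneracy_mul_sum`).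
As `D ℓ` lies in the closed neighbourhoods of both endpoints of `orig ℓ`,
* `|D ℓ| ≤ minDeg (orig ℓ) + 1`;
* `x ∈ D ℓ` only if both endpoints of `orig ℓ` lie in `N[x]`, so that
  `|L x| ≤ |A x| ≤ (d + 1) deg x`; trivially also `|A x| ≤ |𝒞|`.

Hence the intersections for the edge `e` cost `O(min(|𝒞|, (d + 1) minDeg e))`. Each scan of `D ℓ` is
paid for by a vertex that has just joined `C ℓ` (`memberCharge`), and `|C ℓ|` is at most `n` and at
most `d + 1`. Emptying the scratch sets is paid for in advance by their sizes, which enter the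
bound on the steps as a potential (`Progress`). Summing up gives both bounds on the number of steps.

Space and time need little knowledge of the program: any program built from the primitives
gains at most two words per step, and pays for each step at most the cost of an operation in a set
that fits into the peak space (`Tame`). So the space during an iteration is bounded by the space at
its start and the number of its steps, and the time by the number of steps and the peak space, which
is polynomial in `n`.
-/

namespace GlobalAdm

universe u v

/-! ### Degeneracy -/

section Degeneracy

variable {V : Type*} [Fintype V] [DecidableEq V] (G : SimpleGraph V) [DecidableRel G.Adj]

/-- Every nonempty set of vertices induces a subgraph with a vertex of degree at most the
degeneracy. -/
theorem exists_neighborFinset_inter_card_le_degeneracy {U : Finset V} (hU : U.Nonempty) :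
    ∃ x ∈ U, (G.neighborFinset x ∩ U).card ≤ degeneracy G := by
  by_contra! h
  have hbdd : BddAbove {k | ∃ H : G.Subgraph, H.verts.Nonempty ∧
      ∀ x ∈ H.verts, k ≤ (H.neighborSet x).ncard} := by
    refine ⟨Fintype.card V, ?_⟩
    rintro k ⟨H, ⟨x, hx⟩, hk⟩
    refine (hk x hx).trans ?_
    rw [← Nat.card_eq_fintype_card]
    exact Set.ncard_le_card _
  have hmem : degeneracy G + 1 ∈ {k | ∃ H : G.Subgraph, H.verts.Nonempty ∧
      ∀ x ∈ H.verts, k ≤ (H.neighborSet x).ncard} := by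
    refine ⟨(⊤ : G.Subgraph).induce (U : Set V), hU, fun x hx => ?_⟩
    have hx' : x ∈ U := hx
    have : ((⊤ : G.Subgraph).induce (U : Set V)).neighborSet x
        = ((G.neighborFinset x ∩ U : Finset V) : Set V) := by
      ext y
      simp [hx', and_comm]
    rw [this, Set.ncard_coe_finset]
    exact h x hx'
  have := le_csSup hbdd hmem
  unfold degeneracy at this
  omega

/-- Removing vertices of degree at most `d` one at a time charges every edge to the endpoint that is
removed first, and no vertex is charged more than `d` times. -/
theorem sum_inf_map_le_degeneracy_mul_sum (f : V → ℕ) (U : Finset V) (E : Finset (Sym2 V))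
    (hE : E ⊆ G.edgeFinset) (hEU : ∀ e ∈ E, ∀ v ∈ e, v ∈ U) :
    ∑ e ∈ E, (e.map f).inf ≤ degeneracy G * ∑ x ∈ U, f x := by
  induction hn : U.card generalizing U E with
  | zero =>
    have hU : U = ∅ := Finset.card_eq_zero.mp hn
    have : E = ∅ := by
      refine Finset.eq_empty_of_forall_notMem fun e he => ?_
      induction e with
      | _ a b => simpa [hU] using hEU _ he a (by simp)
    simp [this]
  | succ k ih =>
    obtain ⟨x, hx, hdeg⟩ := exists_neighborFinset_inter_card_le_degeneracy G
      (U := U) (Finset.card_pos.mp (by omega))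
    -- edges avoiding `x` are handled by induction, the at most `d` edges at `x` are charged to `x`
    have h1 := ih (U.erase x) (E.filter fun e => x ∉ e) ((Finset.filter_subset _ _).trans hE)
      (fun e he v hv => by
        rw [Finset.mem_filter] at he
        refine Finset.mem_erase.mpr ⟨?_, hEU e he.1 v hv⟩
        rintro rfl
        exact he.2 hv)
      (by rw [Finset.card_erase_of_mem hx]; omega)
    have hcard : (E.filter fun e => x ∈ e).card ≤ degeneracy G := by
      refine le_trans ?_ hdeg
      refine le_trans (Finset.card_le_card (t := (G.neighborFinset x ∩ U).image fun y => s(x, y)) ?_)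
        Finset.card_image_le
      intro e he
      rw [Finset.mem_filter] at he
      obtain ⟨y, rfl⟩ := Sym2.mem_iff_exists.mp he.2
      have hadj : G.Adj x y := by simpa using hE he.1
      exact Finset.mem_image.mpr ⟨y, by simp [hadj, hEU _ he.1 y (by simp)], rfl⟩
    have h2 : ∑ e ∈ E.filter (fun e => x ∈ e), (e.map f).inf ≤ degeneracy G * f x := by
      refine (Finset.sum_le_card_nsmul _ _ (f x) fun e he => ?_).trans
        (Nat.mul_le_mul_right _ hcard)
      obtain ⟨y, rfl⟩ := Sym2.mem_iff_exists.mp (Finset.mem_filter.mp he).2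
      simp
    rw [← Finset.sum_filter_add_sum_filter_not E (fun e => x ∈ e), ← Finset.add_sum_erase U f hx,
      Nat.mul_add]
    exact Nat.add_le_add h2 h1

theorem degeneracy_pos {x y : V} (h : G.Adj x y) : 1 ≤ degeneracy G := by
  have := sum_inf_map_le_degeneracy_mul_sum G (fun _ => 1) Finset.univ {s(x, y)}
    (by simpa using h) (by simp)
  by_contra h0
  simp [show degeneracy G = 0 by omega] at this

theorem card_le_degeneracy_add_one {U : Finset V} (hU : G.IsClique (U : Set V)) :
    U.card ≤ degeneracy G + 1 := by
  rcases U.eq_empty_or_nonempty with rfl | hne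
  · simp
  obtain ⟨x, hx, h⟩ := exists_neighborFinset_inter_card_le_degeneracy G hne
  have : U.erase x ⊆ G.neighborFinset x ∩ U := by
    intro y hy
    rw [Finset.mem_erase] at hy
    simp only [Finset.mem_inter, SimpleGraph.mem_neighborFinset]
    exact ⟨hU hx hy.2 hy.1.symm, hy.2⟩
  have := Finset.card_le_card this
  rw [Finset.card_erase_of_mem hx] at this
  omega

/-- The smaller of the degrees of the two endpoints. -/
def minDeg (e : Sym2 V) : ℕ := (e.map fun v => G.degree v).inf

theorem sum_minDeg_le : ∑ e ∈ G.edgeFinset, minDeg G e ≤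
    2 * degeneracy G * G.edgeFinset.card := by
  refine (sum_inf_map_le_degeneracy_mul_sum G _ Finset.univ _ subset_rfl (by simp)).trans ?_
  rw [G.sum_degrees_eq_twice_card_edges]
  apply le_of_eq; ring

/-- An edge whose endpoints both lie in the closed neighbourhood of `x` is incident to `x` or
lies inside `N(x)`. -/
theorem card_edges_closed_neighborhood_le (x : V) (E : Finset (Sym2 V)) (hE : E ⊆ G.edgeFinset)
    (h : ∀ e ∈ E, ∀ v ∈ e, x = v ∨ G.Adj x v) :
    E.card ≤ (degeneracy G + 1) * G.degree x := by
  have h1 : (E.filter fun e => x ∈ e).card ≤ G.degree x := by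
    rw [← G.card_incidenceFinset_eq_degree]
    refine Finset.card_le_card fun e he => ?_
    rw [Finset.mem_filter] at he
    rw [SimpleGraph.mem_incidenceFinset]
    exact ⟨by simpa using hE he.1, he.2⟩
  have h2 : (E.filter fun e => x ∉ e).card ≤ degeneracy G * G.degree x := by
    have := sum_inf_map_le_degeneracy_mul_sum G (fun _ => 1) (G.neighborFinset x)
      (E.filter fun e => x ∉ e) ((Finset.filter_subset _ _).trans hE) (fun e he v hv => by
        rw [Finset.mem_filter] at he
        rcases h e he.1 v hv with rfl | hv'
        · exact absurd hv he.2
        · simpa using hv')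
    refine le_trans ?_ (this.trans (by simp))
    rw [Finset.card_eq_sum_ones]
    refine Finset.sum_le_sum fun e _ => ?_
    induction e with
    | _ a b => simp
  rw [← Finset.card_filter_add_card_filter_not (s := E) (fun e => x ∈ e)]
  nlinarith

end Degeneracy

/-! ### Accounting that holds for every program -/

section Accounting

variable {V : Type u} [Fintype V] {α β : Type u}

/-- The counters of `s'` are accounted for by those of an earlier state `s`: space grows by at most
two words per step, and each step is charged at most the cost of an operation in a set that fits
into the peak space. -/
structure Acc (s s' : Machine V) : Prop where
  steps_le : s.steps ≤ s'.steps
  words_le : s'.mem.words ≤ s.mem.words + 2 * (s'.steps - s.steps)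
  peak_mono : s.peak ≤ s'.peak
  words_le_peak : s'.mem.words ≤ s'.peak
  peak_le : s'.peak ≤ max s.peak (s.mem.words + 2 * (s'.steps - s.steps))
  time_le : s'.time ≤ s.time + (s'.steps - s.steps) * opCost s'.peak

theorem opCost_mono {a b : ℕ} (h : a ≤ b) : opCost a ≤ opCost b :=
  Nat.add_le_add_right (Nat.log_mono_right h) 1

theorem Acc.refl {s : Machine V} (h : s.mem.words ≤ s.peak) : Acc s s :=
  ⟨le_rfl, by simp, le_rfl, h, by simp, by simp⟩

theorem Acc.trans {s t r : Machine V} (h₁ : Acc s t) (h₂ : Acc t r) : Acc s r where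
  steps_le := h₁.steps_le.trans h₂.steps_le
  words_le := by
    have := h₁.steps_le; have := h₂.steps_le; have := h₁.words_le; have := h₂.words_le
    omega
  peak_mono := h₁.peak_mono.trans h₂.peak_mono
  words_le_peak := h₂.words_le_peak
  peak_le := by
    have := h₁.steps_le; have := h₂.steps_le; have := h₁.words_le; have := h₂.words_le
    have := h₁.peak_le; have := h₂.peak_le
    omega
  time_le := by
    obtain ⟨a, ha⟩ := Nat.exists_eq_add_of_le h₁.steps_le
    obtain ⟨b, hb⟩ := Nat.exists_eq_add_of_le h₂.steps_le
    have e1 := h₁.time_le; have e2 := h₂.time_le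
    have e3 := Nat.mul_le_mul_left a (opCost_mono h₂.peak_mono)
    rw [show t.steps - s.steps = a by omega] at e1
    rw [show r.steps - t.steps = b by omega] at e2
    rw [show r.steps - s.steps = a + b by omega, Nat.add_mul]
    omega

/-- Every run of the program is accounted for. -/
def Tame (p : Prog V α) : Prop := ∀ s : Machine V, s.mem.words ≤ s.peak → Acc s (p s).2

theorem Tame.pure (a : α) : Tame (pure a : Prog V α) := fun _ h => Acc.refl h

theorem Tame.bind {p : Prog V α} {f : α → Prog V β} (hp : Tame p) (hf : ∀ a, Tame (f a)) :
    Tame (p >>= f) := fun s h =>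
  (hp s h).trans (hf _ _ (hp s h).words_le_peak)

theorem Tame.ite {c : Prop} [Decidable c] {p q : Prog V α} (hp : Tame p) (hq : Tame q) :
    Tame (if c then p else q) := by
  split <;> assumption

theorem Acc.exec {s : Machine V} {a c : ℕ} {f : Memory V → Memory V}
    (hw : (f s.mem).words ≤ s.mem.words + 2 * a)
    (hc : c ≤ a * opCost s.peak) : Acc s (exec a c f s).2 where
  steps_le := Nat.le_add_right _ _
  words_le := by
    change (f s.mem).words ≤ _ + 2 * (s.steps + a - s.steps)
    omega
  peak_mono := le_max_left _ _
  words_le_peak := le_max_right _ _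
  peak_le := by
    change max s.peak (f s.mem).words ≤ max _ (_ + 2 * (s.steps + a - s.steps))
    omega
  time_le := by
    change s.time + c ≤ s.time + (s.steps + a - s.steps) * opCost (max s.peak (f s.mem).words)
    rw [Nat.add_sub_cancel_left]
    have := Nat.mul_le_mul_left a (opCost_mono (le_max_left s.peak (f s.mem).words))
    omega

/-- Reading a set variable yields a set that fits into the space in use, and writing to it changes
the space in use accordingly. -/
structure SetVar.Fits {β : Type v} (x : SetVar V β) : Prop where
  card_le : ∀ M, (x.get M).card ≤ M.words
  words_set : ∀ M s, (x.set s M).words ≤ M.words + (s.card - (x.get M).card)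

variable {δ : Type v} {x y z : SetVar V δ}

theorem one_le_opCost (k : ℕ) : 1 ≤ opCost k := Nat.le_add_left _ _

theorem SetVar.Fits.opCost_le (hx : x.Fits) {s : Machine V} (h : s.mem.words ≤ s.peak) :
    opCost (x.get s.mem).card ≤ opCost s.peak :=
  opCost_mono ((hx.card_le _).trans h)

theorem tame_size : Tame (size x) := fun _ _ =>
  Acc.exec (a := 1) (c := 1) (f := id) (by simp) (by simpa using one_le_opCost _)

theorem tame_test [DecidableEq δ] (hx : x.Fits) (b : δ) : Tame (test x b) := fun s h =>
  Acc.exec (a := 1) (f := id) (by simp) (by simpa using hx.opCost_le h)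

theorem tame_insert [DecidableEq δ] (hx : x.Fits) (b : δ) : Tame (insert x b) := fun s h =>
  Acc.exec (a := 1)
    (by
      have := hx.words_set s.mem (Insert.insert b (x.get s.mem))
      have := Finset.card_insert_le b (x.get s.mem)
      omega)
    (by simpa using hx.opCost_le h)

theorem tame_delete [DecidableEq δ] (hx : x.Fits) (b : δ) : Tame (delete x b) := fun s h =>
  Acc.exec (a := 1)
    (by
      have := hx.words_set s.mem ((x.get s.mem).erase b)
      have := Finset.card_erase_le (s := x.get s.mem) (a := b)
      omega)
    (by simpa using hx.opCost_le h)

theorem tame_clear (hx : x.Fits) : Tame (clear x) := fun s _ =>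
  Acc.exec
    (by
      have := hx.words_set s.mem ∅
      simp only [Finset.card_empty] at this
      omega)
    (Nat.le_mul_of_pos_right _ (one_le_opCost _))

theorem tame_select {x : SetVar V ℕ} (hx : x.Fits) (pick : ℕ → Finset ℕ → ℕ) :
    Tame (select pick x) := fun s h =>
  Acc.exec (a := 1) (f := id) (by simp) (by simpa using hx.opCost_le h)

theorem tame_newLabel : Tame (newLabel : Prog V (ULift ℕ)) := fun s _ =>
  Acc.exec (a := 1) (c := 1)
    (f := fun M => { M with
      k := M.k + 1, C := Function.update M.C M.k ∅, D := Function.update M.D M.k ∅ })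
    (by
      simp only [Memory.words, Finset.sum_range_succ, Function.update_self, Finset.card_empty]
      have : ∀ ℓ ∈ Finset.range s.mem.k,
          ((Function.update s.mem.C s.mem.k ∅ ℓ).card + 1 +
            ((Function.update s.mem.D s.mem.k ∅ ℓ).card + 1)) =
          ((s.mem.C ℓ).card + 1 + ((s.mem.D ℓ).card + 1)) := by
        intro ℓ hℓ
        have : ℓ ≠ s.mem.k := (Finset.mem_range.mp hℓ).ne
        simp [Function.update_of_ne this]
      rw [Finset.sum_congr rfl this]
      omega)
    (by simpa using one_le_opCost _)

theorem acc_forList {c : ℕ} {body : δ → Prog V PUnit} (hb : ∀ b, Tame (body b)) (l : List δ)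
    (s : Machine V) (h : s.mem.words ≤ s.peak) (hc : c ≤ opCost s.peak) :
    Acc s (forList c body l s).2 := by
  induction l generalizing s with
  | nil => exact Acc.refl h
  | cons b l ih =>
    have h1 : Acc s (exec 1 c id s).2 := Acc.exec (by simp) (by simpa using hc)
    have h2 := h1.trans (hb b _ h1.words_le_peak)
    exact h2.trans (ih _ h2.words_le_peak (hc.trans (opCost_mono h2.peak_mono)))

theorem tame_forList {body : δ → Prog V PUnit} (hb : ∀ b, Tame (body b)) (l : List δ) :
    Tame (forList 1 body l) := fun s h => acc_forList hb l s h (one_le_opCost _)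

theorem tame_forEach (hx : x.Fits) {body : δ → Prog V PUnit} (hb : ∀ b, Tame (body b)) :
    Tame (forEach x body) := fun s h => acc_forList hb _ s h (hx.opCost_le h)

theorem tame_intersect [DecidableEq δ] (hx : x.Fits) (hy : y.Fits) (hz : z.Fits) :
    Tame (intersect x y z) := by
  refine (tame_clear hz).bind fun _ => tame_size.bind fun a => tame_size.bind fun b => ?_
  refine Tame.ite (tame_forEach hx fun e => ?_) (tame_forEach hy fun e => ?_)
  · exact (tame_test hy e).bind fun _ => Tame.ite (tame_insert hz e) (Tame.pure _)
  · exact (tame_test hx e).bind fun _ => Tame.ite (tame_insert hz e) (Tame.pure _)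

end Accounting

section SetVariables

variable {V : Type u} [Fintype V]

theorem card_univ_le_words (M : Memory V) : 2 * Fintype.card V ≤ M.words := by
  have : ∑ x : V, 2 ≤ ∑ x, ((M.L x).card + 1 + ((M.A x).card + 1)) :=
    Finset.sum_le_sum fun x _ => by omega
  simp only [Finset.sum_const, Finset.card_univ, smul_eq_mul] at this
  unfold Memory.words
  omega

theorem sum_update_le {ι γ : Type*} [DecidableEq ι] (s : Finset ι) (f : ι → Finset γ) (i : ι)
    (t : Finset γ) (g : ι → ℕ) :
    ∑ j ∈ s, ((Function.update f i t j).card + g j) ≤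
      ∑ j ∈ s, ((f j).card + g j) + (t.card - (f i).card) := by
  by_cases hi : i ∈ s
  · rw [← Finset.add_sum_erase s _ hi, ← Finset.add_sum_erase s (fun j => (f j).card + g j) hi]
    rw [Finset.sum_congr rfl (g := fun j => (f j).card + g j) fun j hj => by
      rw [Function.update_of_ne (Finset.ne_of_mem_erase hj)]]
    simp only [Function.update_self]
    omega
  · rw [Finset.sum_congr rfl (g := fun j => (f j).card + g j) fun j hj => by
      rw [Function.update_of_ne (ne_of_mem_of_not_mem hj hi)]]
    omega

/-- Writing to `C ℓ` for a label `ℓ` that is not in use leaves the space in use unchanged; this is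
why `SetVar.Fits` bounds the space from above only. -/
theorem fits_vC (ℓ : ℕ) : (vC ℓ : SetVar V V).Fits where
  card_le M := by
    have := card_univ_le_words M
    have := Finset.card_le_univ ((vC ℓ).get M)
    omega
  words_set M s := by
    have := sum_update_le (Finset.range M.k) M.C ℓ s (fun ℓ => 1 + ((M.D ℓ).card + 1))
    simp only [Memory.words, vC, Nat.add_assoc] at this ⊢
    omega

theorem fits_vD (ℓ : ℕ) : (vD ℓ : SetVar V V).Fits where
  card_le M := by
    have := card_univ_le_words M
    have := Finset.card_le_univ ((vD ℓ).get M)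
    omega
  words_set M s := by
    have := sum_update_le (Finset.range M.k) M.D ℓ s (fun ℓ => (M.C ℓ).card + 2)
    simp only [Memory.words, vD] at this ⊢
    simp only [show ∀ a b : ℕ, a + 1 + (b + 1) = b + (a + 2) by intros; omega] at this ⊢
    omega

theorem fits_vS : (vS : SetVar V ℕ).Fits where
  card_le M := by
    simp only [Memory.words, vS]
    omega
  words_set M s := by
    simp only [Memory.words, vS]
    omega

theorem fits_vX : (vX : SetVar V V).Fits where
  card_le M := by
    simp only [Memory.words, vX]
    omega
  words_set M s := by
    simp only [Memory.words, vX]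
    omega

variable [DecidableEq V]

theorem fits_vN (x : V) : (vN x).Fits where
  card_le M := by
    have := card_univ_le_words M
    have := Finset.card_le_univ ((vN x).get M)
    omega
  words_set M s := Nat.le_add_right M.words _

theorem fits_vL (x : V) : (vL x).Fits where
  card_le M := by
    have := Finset.single_le_sum (f := fun x => (M.L x).card + 1 + ((M.A x).card + 1))
      (fun _ _ => Nat.zero_le _) (Finset.mem_univ x)
    change (M.L x).card ≤ _
    unfold Memory.words
    omega
  words_set M s := by
    have := sum_update_le Finset.univ M.L x s (fun x => 1 + ((M.A x).card + 1))
    simp only [Memory.words, vL, Nat.add_assoc] at this ⊢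
    omega

theorem fits_vA (x : V) : (vA x).Fits where
  card_le M := by
    have := Finset.single_le_sum (f := fun x => (M.L x).card + 1 + ((M.A x).card + 1))
      (fun _ _ => Nat.zero_le _) (Finset.mem_univ x)
    change (M.A x).card ≤ _
    unfold Memory.words
    omega
  words_set M s := by
    have := sum_update_le Finset.univ M.A x s (fun x => (M.L x).card + 2)
    simp only [Memory.words, vA] at this ⊢
    simp only [show ∀ a b : ℕ, a + 1 + (b + 1) = b + (a + 2) by intros; omega]
    omega

theorem tame_extendClique (ℓ : ℕ) (x y : V) : Tame (extendClique ℓ x y) := by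
  refine (tame_insert (fits_vL x) ℓ).bind fun _ => (tame_insert (fits_vL y) ℓ).bind fun _ =>
    (tame_insert (fits_vC ℓ) x).bind fun _ => (tame_insert (fits_vC ℓ) y).bind fun _ =>
    (tame_clear fits_vX).bind fun _ => Tame.bind (tame_forEach (fits_vD ℓ) fun w => ?_) fun _ =>
    tame_forEach fits_vX fun w => ?_
  · refine (tame_test (fits_vC ℓ) w).bind fun c => Tame.ite ?_ (Tame.pure _)
    exact (tame_test (fits_vN x) w).bind fun _ => (tame_test (fits_vN y) w).bind fun _ =>
      Tame.ite (tame_insert fits_vX w) (Tame.pure _)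
  · exact (tame_delete (fits_vD ℓ) w).bind fun _ => tame_delete (fits_vA w) ℓ

theorem tame_createClique (x y : V) : Tame (createClique x y) :=
  tame_newLabel.bind fun l =>
    (tame_insert (fits_vC l.down) x).bind fun _ => (tame_insert (fits_vC l.down) y).bind fun _ =>
    (tame_insert (fits_vL x) l.down).bind fun _ => (tame_insert (fits_vL y) l.down).bind fun _ =>
    (tame_intersect (fits_vN x) (fits_vN y) (fits_vD l.down)).bind fun _ =>
    (tame_insert (fits_vD l.down) x).bind fun _ => (tame_insert (fits_vD l.down) y).bind fun _ =>
    tame_forEach (fits_vD l.down) fun w => tame_insert (fits_vA w) l.down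

theorem tame_processEdge (pick : ℕ → Finset ℕ → ℕ) (x y : V) : Tame (processEdge pick x y) := by
  refine (tame_intersect (fits_vL x) (fits_vL y) fits_vS).bind fun _ => tame_size.bind fun _ =>
    Tame.ite ((tame_intersect (fits_vA x) (fits_vA y) fits_vS).bind fun _ => tame_size.bind fun _ =>
    Tame.ite ?_ (tame_createClique x y)) (Tame.pure _)
  exact (tame_select fits_vS pick).bind fun ℓ => tame_extendClique ℓ.down x y

end SetVariables

/-! ### What the programs do to the memory -/

section Semantics

variable {V : Type u} [Fintype V]

variable {δ : Type v} [DecidableEq δ]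

/-- A scan of a set, where `F T` is the memory after the elements of `T` have been treated. -/
theorem forEach_spec {x : SetVar V δ} {body : δ → Prog V PUnit} {s : Machine V} {a : ℕ}
    (F : Finset δ → Memory V) (h0 : s.mem = F ∅)
    (hF : ∀ (T : Finset δ) (b : δ) (r : Machine V), b ∈ x.get s.mem → r.mem = F T →
      (body b r).2.mem = F (Insert.insert b T) ∧ (body b r).2.steps ≤ r.steps + a) :
    (forEach x body s).2.mem = F (x.get s.mem) ∧
      (forEach x body s).2.steps ≤ s.steps + (a + 1) * (x.get s.mem).card := by
  have key : ∀ (c : ℕ) (l : List δ) (T : Finset δ) (r : Machine V), (∀ b ∈ l, b ∈ x.get s.mem) →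
      r.mem = F T → (forList c body l r).2.mem = F (T ∪ l.toFinset) ∧
        (forList c body l r).2.steps ≤ r.steps + (a + 1) * l.length := by
    intro c l
    induction l with
    | nil => exact fun T r _ hr => ⟨by
        rw [List.toFinset_nil, Finset.union_empty]; exact hr, Nat.le_add_right _ _⟩
    | cons b l ih =>
      intro T r hl hr
      obtain ⟨h1, h2⟩ := hF T b (exec 1 c id r).2 (hl b (by simp)) hr
      obtain ⟨h3, h4⟩ := ih _ _ (fun b' hb' => hl b' (by simp [hb'])) h1
      have e : (forList c body (b :: l) r) = forList c body l (body b (exec 1 c id r).2).2 := rfl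
      have e2 : (exec 1 c id r).2.steps = r.steps + 1 := rfl
      rw [e]
      refine ⟨?_, ?_⟩
      · rw [h3, List.toFinset_cons, Finset.insert_union, Finset.union_insert]
      · rw [List.length_cons, Nat.mul_add]
        omega
  have := key (opCost (x.get s.mem).card) (x.get s.mem).toList ∅ s (by simp) h0
  rw [Finset.length_toList, Finset.toList_toFinset, Finset.empty_union] at this
  exact this

/-- Reading and writing set variables is consistent, and writing to `z` affects neither `x`
nor `y`. -/
structure SetVar.Independent (x y z : SetVar V δ) : Prop where
  get_left : ∀ s M, x.get (z.set s M) = x.get M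
  get_right : ∀ s M, y.get (z.set s M) = y.get M
  get_set : ∀ s M, z.get (z.set s M) = s
  set_set : ∀ s t M, z.set s (z.set t M) = z.set s M

theorem intersect_spec {x y z : SetVar V δ} (h : SetVar.Independent x y z) (s : Machine V) :
    (intersect x y z s).2.mem = z.set (x.get s.mem ∩ y.get s.mem) s.mem ∧
      (intersect x y z s).2.steps ≤ s.steps + (z.get s.mem).card + 3 +
        3 * min (x.get s.mem).card (y.get s.mem).card := by
  -- the scan of `u` that collects the elements of `w`
  have key : ∀ (u w : SetVar V δ), SetVar.Independent u w z → ∀ r : Machine V,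
      r.mem = z.set ∅ s.mem →
      (forEach u (fun e => do
        let t ← test w e
        if t.down then insert z e) r).2.mem = z.set (u.get s.mem ∩ w.get s.mem) s.mem ∧
      (forEach u (fun e => do
        let t ← test w e
        if t.down then insert z e) r).2.steps ≤ r.steps + 3 * (u.get s.mem).card := by
    intro u w huw r hr
    have hu : u.get r.mem = u.get s.mem := by rw [hr, huw.get_left]
    rw [← hu]
    set body : δ → Prog V PUnit := fun e => do
      let t ← test w e
      if t.down then insert z e with hbody
    refine forEach_spec (a := 2) (fun T => z.set (T ∩ w.get s.mem) s.mem) (by simpa using hr) ?_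
    intro T b q _ hq
    by_cases hb : b ∈ w.get s.mem
    · have : b ∈ w.get q.mem := by rwa [hq, huw.get_right]
      have e : body b q = (if decide (b ∈ w.get q.mem) = true then insert z b else Pure.pure ⟨⟩ :
          Prog V PUnit) (test w b q).2 := rfl
      rw [e, if_pos (by simpa using this)]
      refine ⟨?_, le_rfl⟩
      change z.set (Insert.insert b (z.get q.mem)) q.mem = _
      rw [hq, huw.get_set, huw.set_set, Finset.insert_inter_of_mem hb]
    · have : b ∉ w.get q.mem := by rwa [hq, huw.get_right]
      have e : body b q = (if decide (b ∈ w.get q.mem) = true then insert z b else Pure.pure ⟨⟩ :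
          Prog V PUnit) (test w b q).2 := rfl
      rw [e, if_neg (by simpa using this)]
      refine ⟨?_, Nat.le_succ _⟩
      change q.mem = _
      rw [hq, Finset.insert_inter_of_notMem hb]
  set r : Machine V := (size y (size x (clear z s).2).2).2 with hr
  have hm : r.mem = z.set ∅ s.mem := rfl
  have hs : r.steps = s.steps + ((z.get s.mem).card + 1) + 1 + 1 := rfl
  have e : intersect x y z s =
      (if (x.get (z.set ∅ s.mem)).card ≤ (y.get (z.set ∅ s.mem)).card then
        forEach x fun e => do
          let t ← test y e
          if t.down then insert z e
      else
        forEach y fun e => do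
          let t ← test x e
          if t.down then insert z e) r := rfl
  rw [e, h.get_left, h.get_right]
  split_ifs with hc
  · obtain ⟨h1, h2⟩ := key x y h r hm
    refine ⟨h1, h2.trans ?_⟩
    omega
  · obtain ⟨h1, h2⟩ := key y x ⟨h.get_right, h.get_left, h.get_set, h.set_set⟩ r hm
    refine ⟨by rw [h1, Finset.inter_comm], h2.trans ?_⟩
    omega

end Semantics

section Algorithm

variable {V : Type u} [Fintype V] [DecidableEq V]

/-- The vertices of `D ℓ \ C ℓ` that are not adjacent to both `x` and `y`, once `x` and `y` have
joined `C ℓ`. -/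
def dropped (M : Memory V) (ℓ : ℕ) (x y : V) : Finset V :=
  (M.D ℓ).filter fun w => w ∉ Insert.insert y (Insert.insert x (M.C ℓ)) ∧
    ¬ (w ∈ M.N x ∧ w ∈ M.N y)

/-- The memory after the clique `C ℓ` has taken in the edge `{x, y}`. -/
def extendMemory (M : Memory V) (ℓ : ℕ) (x y : V) : Memory V :=
  { M with
    L := fun z => if z = x ∨ z = y then Insert.insert ℓ (M.L z) else M.L z
    C := Function.update M.C ℓ (Insert.insert y (Insert.insert x (M.C ℓ)))
    X := dropped M ℓ x y
    D := Function.update M.D ℓ (M.D ℓ \ dropped M ℓ x y)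
    A := fun w => if w ∈ dropped M ℓ x y then (M.A w).erase ℓ else M.A w }

/-- The memory after the creation of the clique `{x, y}`, with the new label `M.k`. -/
def createMemory (M : Memory V) (x y : V) : Memory V :=
  { M with
    k := M.k + 1
    L := fun z => if z = x ∨ z = y then Insert.insert M.k (M.L z) else M.L z
    C := Function.update M.C M.k {x, y}
    D := Function.update M.D M.k (Insert.insert y (Insert.insert x (M.N x ∩ M.N y)))
    A := fun w => if w ∈ Insert.insert y (Insert.insert x (M.N x ∩ M.N y))
      then Insert.insert M.k (M.A w) else M.A w }

theorem update_update_insert {ι : Type*} {γ : Type*} [DecidableEq ι] [DecidableEq γ]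
    (f : ι → Finset γ) (c : γ) (x y : ι) :
    Function.update (Function.update f x (Insert.insert c (f x))) y
      (Insert.insert c (Function.update f x (Insert.insert c (f x)) y)) =
    fun z => if z = x ∨ z = y then Insert.insert c (f z) else f z := by
  funext z
  by_cases hy : z = y
  · subst hy
    by_cases hx : z = x
    · subst hx; simp
    · simp [hx]
  · by_cases hx : z = x
    · subst hx; simp [hy]
    · simp [hx, hy]

theorem extendClique_spec (ℓ : ℕ) (x y : V) (s : Machine V) :
    (extendClique ℓ x y s).2.mem = extendMemory s.mem ℓ x y ∧
      (extendClique ℓ x y s).2.steps ≤ s.steps + s.mem.X.card + 5 + 8 * (s.mem.D ℓ).card := by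
  set M := s.mem with hM
  set r : Machine V := (clear vX (insert (vC ℓ) y (insert (vC ℓ) x (insert (vL y) ℓ
    (insert (vL x) ℓ s).2).2).2).2).2 with hr
  set M₁ : Memory V := { M with
    L := fun z => if z = x ∨ z = y then Insert.insert ℓ (M.L z) else M.L z
    C := Function.update M.C ℓ (Insert.insert y (Insert.insert x (M.C ℓ))) } with hM₁
  have hrm : r.mem = { M₁ with X := ∅ } := by
    have : r.mem = { M with
      L := Function.update (Function.update M.L x (Insert.insert ℓ (M.L x))) y
        (Insert.insert ℓ (Function.update M.L x (Insert.insert ℓ (M.L x)) y))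
      C := Function.update (Function.update M.C ℓ (Insert.insert x (M.C ℓ))) ℓ
        (Insert.insert y (Function.update M.C ℓ (Insert.insert x (M.C ℓ)) ℓ))
      X := ∅ } := rfl
    rw [this, update_update_insert, Function.update_idem, Function.update_self]
  have hrs : r.steps = s.steps + 1 + 1 + 1 + 1 + (M.X.card + 1) := rfl
  set scanAdj : V → Prog V PUnit := fun w => do
      let a ← test (vN x) w
      let b ← test (vN y) w
      if !(a.down && b.down) then insert vX w with hscanAdj
  set scan : V → Prog V PUnit := fun w => do
      let c ← test (vC ℓ) w
      if !c.down then
        scanAdj w with hscan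
  set purge : V → Prog V PUnit := fun w => do
    delete (vD ℓ) w
    delete (vA w) ℓ with hpurge
  have e : extendClique ℓ x y s = forEach vX purge (forEach (vD ℓ) scan r).2 := rfl
  have h1 := forEach_spec (x := vD ℓ) (body := scan) (s := r) (a := 4)
    (fun T => { M₁ with X := T.filter fun w => w ∉ Insert.insert y (Insert.insert x (M.C ℓ)) ∧
      ¬ (w ∈ M.N x ∧ w ∈ M.N y) }) (by simpa using hrm) (by
    intro T b q _ hq
    have hC : q.mem.C ℓ = Insert.insert y (Insert.insert x (M.C ℓ)) := by
      rw [hq]; simp [hM₁]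
    have hN : q.mem.N = M.N := by rw [hq]
    by_cases hb : b ∈ Insert.insert y (Insert.insert x (M.C ℓ))
    · have e : scan b q = (if !(decide (b ∈ q.mem.C ℓ)) then scanAdj b else Pure.pure ⟨⟩ :
          Prog V PUnit) (test (vC ℓ) b q).2 := rfl
      rw [e, hC]
      simp only [hb, decide_true, Bool.not_true, Bool.false_eq_true, if_false]
      refine ⟨?_, ?_⟩
      · change q.mem = _
        rw [hq, Finset.filter_insert, if_neg (by simp only [hb]; simp)]
      · change q.steps + 1 ≤ _
        omega
    · have e : scan b q = (if !(decide (b ∈ q.mem.C ℓ)) then scanAdj b else Pure.pure ⟨⟩ :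
          Prog V PUnit) (test (vC ℓ) b q).2 := rfl
      rw [e, hC]
      simp only [hb, decide_false, Bool.not_false, if_true]
      have e2 : scanAdj b (test (vC ℓ) b q).2 = (if !(decide (b ∈ q.mem.N x) && decide (b ∈ q.mem.N y)) then
            insert vX b else Pure.pure ⟨⟩ : Prog V PUnit)
            (test (vN y) b (test (vN x) b (test (vC ℓ) b q).2).2).2 := rfl
      rw [e2, hN]
      by_cases hab : b ∈ M.N x ∧ b ∈ M.N y
      · simp only [hab.1, hab.2, decide_true, Bool.and_true, Bool.not_true, Bool.false_eq_true,
          if_false]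
        refine ⟨?_, ?_⟩
        · change q.mem = _
          rw [hq, Finset.filter_insert, if_neg (by simp [hab])]
        · change q.steps + 1 + 1 + 1 ≤ _
          omega
      · rw [if_pos (by simpa [imp_iff_not_or] using hab)]
        refine ⟨?_, ?_⟩
        · change { q.mem with X := Insert.insert b q.mem.X } = _
          rw [hq, Finset.filter_insert, if_pos ⟨hb, hab⟩]
        · change q.steps + 1 + 1 + 1 + 1 ≤ _
          omega)
  obtain ⟨h1m, h1s⟩ := h1
  have hD : (vD ℓ).get r.mem = M.D ℓ := by rw [hrm]; rfl
  rw [hD] at h1m h1s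
  set q := (forEach (vD ℓ) scan r).2 with hq
  change q.mem = { M₁ with X := dropped M ℓ x y } at h1m
  have hX : vX.get q.mem = dropped M ℓ x y := by rw [h1m]; rfl
  have h2 := forEach_spec (x := vX) (body := purge) (s := q) (a := 2)
    (fun T => { M₁ with
      X := dropped M ℓ x y
      D := Function.update M.D ℓ (M.D ℓ \ T)
      A := fun w => if w ∈ T then (M.A w).erase ℓ else M.A w }) (by
    rw [h1m]; simp [hM₁]) (by
    intro T b p _ hp
    refine ⟨?_, le_rfl⟩
    have : (purge b p).2.mem = { p.mem with
      D := Function.update p.mem.D ℓ ((p.mem.D ℓ).erase b)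
      A := Function.update p.mem.A b ((p.mem.A b).erase ℓ) } := rfl
    rw [this, hp]
    simp only [Function.update_self, Function.update_idem]
    congr 1
    · funext w
      by_cases hw : w = b
      · subst hw
        by_cases hT : w ∈ T <;> simp [hT]
      · simp [hw]
    · congr 1
      ext w
      simp only [Finset.mem_erase, Finset.mem_sdiff, Finset.mem_insert]
      tauto)
  obtain ⟨h2m, h2s⟩ := h2
  rw [hX] at h2m h2s
  have hcard : (dropped M ℓ x y).card ≤ (M.D ℓ).card := Finset.card_filter_le _ _
  rw [e]
  refine ⟨h2m, ?_⟩
  omega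

theorem createClique_spec (x y : V) (s : Machine V)
    (hNx : y ∈ s.mem.N x) (hNy : x ∈ s.mem.N y) :
    (createClique x y s).2.mem = createMemory s.mem x y ∧
      (createClique x y s).2.steps ≤
        s.steps + 14 + 5 * min (s.mem.N x).card (s.mem.N y).card := by
  set M := s.mem with hM
  set r : Machine V := (insert (vL y) M.k (insert (vL x) M.k (insert (vC M.k) y
    (insert (vC M.k) x (newLabel s).2).2).2).2).2 with hr
  set M₁ : Memory V := { M with
    k := M.k + 1
    L := fun z => if z = x ∨ z = y then Insert.insert M.k (M.L z) else M.L z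
    C := Function.update M.C M.k {x, y} } with hM₁
  have hrm : r.mem = { M₁ with D := Function.update M.D M.k ∅ } := by
    have : r.mem = { M with
      k := M.k + 1
      L := Function.update (Function.update M.L x (Insert.insert M.k (M.L x))) y
        (Insert.insert M.k (Function.update M.L x (Insert.insert M.k (M.L x)) y))
      C := Function.update (Function.update (Function.update M.C M.k ∅) M.k
          (Insert.insert x (Function.update M.C M.k ∅ M.k))) M.k
        (Insert.insert y (Function.update (Function.update M.C M.k ∅) M.k
          (Insert.insert x (Function.update M.C M.k ∅ M.k)) M.k))
      D := Function.update M.D M.k ∅ } := rfl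
    rw [this, update_update_insert]
    simp only [Function.update_idem, Function.update_self, hM₁]
    congr 2
    ext z
    simp [or_comm]
  have hrs : r.steps = s.steps + 1 + 1 + 1 + 1 + 1 := rfl
  have hint : SetVar.Independent (vN x) (vN y) (vD M.k : SetVar V V) :=
    ⟨fun _ _ => rfl, fun _ _ => rfl, fun _ _ => Function.update_self .., fun _ _ N => by
      simp [vD]⟩
  obtain ⟨h1m, h1s⟩ := intersect_spec hint r
  have hNr : ∀ z, (vN z).get r.mem = M.N z := fun z => by rw [hrm]; rfl
  have hDr : (vD M.k).get r.mem = ∅ := by rw [hrm]; exact Function.update_self ..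
  rw [hNr, hNr] at h1m h1s
  rw [hDr] at h1s
  set q : Machine V := (intersect (vN x) (vN y) (vD M.k) r).2 with hq
  set p : Machine V := (insert (vD M.k) y (insert (vD M.k) x q).2).2 with hp
  set D' : Finset V := Insert.insert y (Insert.insert x (M.N x ∩ M.N y)) with hD'
  have hqm : q.mem = { M₁ with D := Function.update M.D M.k (M.N x ∩ M.N y) } := by
    rw [h1m, hrm]
    simp [vD]
  have hpm : p.mem = { M₁ with D := Function.update M.D M.k D' } := by
    have : p.mem = { q.mem with
      D := Function.update (Function.update q.mem.D M.k (Insert.insert x (q.mem.D M.k))) M.k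
        (Insert.insert y (Function.update q.mem.D M.k (Insert.insert x (q.mem.D M.k)) M.k)) } := rfl
    rw [this, hqm]
    simp only [Function.update_idem, Function.update_self, hD']
  have hps : p.steps = q.steps + 1 + 1 := rfl
  have hDp : (vD M.k).get p.mem = D' := by rw [hpm]; exact Function.update_self ..
  have h2 := forEach_spec (x := vD M.k) (body := fun w => insert (vA w) M.k) (s := p) (a := 1)
    (fun T => { M₁ with
      D := Function.update M.D M.k D'
      A := fun w => if w ∈ T then Insert.insert M.k (M.A w) else M.A w }) (by
    rw [hpm]; simp [hM₁]) (by
    intro T b t _ ht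
    refine ⟨?_, le_rfl⟩
    have : (insert (vA b) M.k t).2.mem = { t.mem with
      A := Function.update t.mem.A b (Insert.insert M.k (t.mem.A b)) } := rfl
    rw [this, ht]
    refine congrArg (fun A => ({ M₁ with D := Function.update M.D M.k D', A := A } : Memory V)) ?_
    funext w
    by_cases hw : w = b
    · subst hw
      by_cases hT : w ∈ T <;> simp [hT]
    · simp [hw])
  obtain ⟨h2m, h2s⟩ := h2
  rw [hDp] at h2m h2s
  -- `D'` lies in both closed neighbourhoods
  have hc : D'.card ≤ min (M.N x).card (M.N y).card + 1 := by
    have hx : D' ⊆ Insert.insert x (M.N x) := by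
      intro z
      simp only [hD', Finset.mem_insert, Finset.mem_inter]
      rintro (rfl | rfl | h)
      · exact Or.inr hNx
      · exact Or.inl rfl
      · exact Or.inr h.1
    have hy : D' ⊆ Insert.insert y (M.N y) := by
      intro z
      simp only [hD', Finset.mem_insert, Finset.mem_inter]
      rintro (rfl | rfl | h)
      · exact Or.inl rfl
      · exact Or.inr hNy
      · exact Or.inr h.2
    have := (Finset.card_le_card hx).trans (Finset.card_insert_le _ _)
    have := (Finset.card_le_card hy).trans (Finset.card_insert_le _ _)
    omega
  have e : createClique x y s = forEach (vD M.k) (fun w => insert (vA w) M.k) p := rfl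
  rw [e]
  refine ⟨h2m, ?_⟩
  simp only [Finset.card_empty] at h1s
  omega

/-- The three ways in which an edge `{x, y}` is treated: it is already covered, or a clique takes it
in, or it starts a clique. -/
theorem processEdge_spec (pick : ℕ → Finset ℕ → ℕ) (hpick : ∀ t S, S.Nonempty → pick t S ∈ S)
    (x y : V) (s : Machine V) (hNx : y ∈ s.mem.N x) (hNy : x ∈ s.mem.N y) :
    let M := s.mem
    let M₁ := { M with S := M.L x ∩ M.L y }
    let M₂ := { M with S := M.A x ∩ M.A y }
    let r := (processEdge pick x y s).2
    let b := min (M.L x).card (M.L y).card + min (M.A x).card (M.A y).card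
    ((M.L x ∩ M.L y).Nonempty ∧ r.mem = M₁ ∧ r.steps ≤ s.steps + M.S.card + 20 + 4 * b) ∨
    (M.L x ∩ M.L y = ∅ ∧ ∃ ℓ ∈ M.A x ∩ M.A y, r.mem = extendMemory M₂ ℓ x y ∧
      r.steps ≤ s.steps + M.S.card + M.X.card + 20 + 4 * b + 8 * (M.D ℓ).card) ∨
    (M.L x ∩ M.L y = ∅ ∧ M.A x ∩ M.A y = ∅ ∧ r.mem = createMemory M₂ x y ∧
      r.steps ≤ s.steps + M.S.card + 30 + 4 * b + 5 * min (M.N x).card (M.N y).card) := by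
  intro M M₁ M₂ r b
  have hL : SetVar.Independent (vL x) (vL y) (vS : SetVar V ℕ) :=
    ⟨fun _ _ => rfl, fun _ _ => rfl, fun _ _ => rfl, fun _ _ _ => rfl⟩
  have hA : SetVar.Independent (vA x) (vA y) (vS : SetVar V ℕ) :=
    ⟨fun _ _ => rfl, fun _ _ => rfl, fun _ _ => rfl, fun _ _ _ => rfl⟩
  obtain ⟨h1m, h1s⟩ := intersect_spec hL s
  set s₁ : Machine V := (intersect (vL x) (vL y) vS s).2 with hs₁
  change s₁.mem = M₁ at h1m
  change s₁.steps ≤ s.steps + M.S.card + 3 + 3 * min (M.L x).card (M.L y).card at h1s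
  set s₂ : Machine V := (size vS s₁).2 with hs₂
  have h2m : s₂.mem = M₁ := h1m
  have h2s : s₂.steps = s₁.steps + 1 := rfl
  have hS1 : s₁.mem.S = M.L x ∩ M.L y := by rw [h1m]
  have hr1 : r = ((if s₁.mem.S.card = 0 then do
      intersect (vA x) (vA y) vS
      let a ← size (vS (V := V))
      if a.down ≠ 0 then
        let ℓ ← select pick (vS (V := V))
        extendClique ℓ.down x y
      else
        createClique x y
      else Pure.pure ⟨⟩ : Prog V PUnit) s₂).2 := rfl
  by_cases hc : (M.L x ∩ M.L y).card = 0
  swap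
  · left
    rw [hS1, if_neg hc] at hr1
    have hr2 : r = s₂ := hr1
    refine ⟨Finset.card_pos.mp (by omega), by rw [hr2, h2m], ?_⟩
    rw [hr2]
    omega
  right
  rw [hS1, if_pos hc] at hr1
  rw [Finset.card_eq_zero] at hc
  obtain ⟨h3m, h3s⟩ := intersect_spec hA s₂
  set s₃ : Machine V := (intersect (vA x) (vA y) vS s₂).2 with hs₃
  have h3m' : s₃.mem = M₂ := by rw [h3m, h2m]; rfl
  have h3s' : s₃.steps ≤ s₂.steps + (M.L x ∩ M.L y).card + 3 +
      3 * min (M.A x).card (M.A y).card := by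
    rw [h2m] at h3s; exact h3s
  have hS3 : s₃.mem.S = M.A x ∩ M.A y := by rw [h3m']
  set s₄ : Machine V := (size vS s₃).2 with hs₄
  have h4m : s₄.mem = M₂ := h3m'
  have h4s : s₄.steps = s₃.steps + 1 := rfl
  have hr2 : r = ((if s₃.mem.S.card ≠ 0 then do
        let ℓ ← select pick (vS (V := V))
        extendClique ℓ.down x y
      else
        createClique x y : Prog V PUnit) s₄).2 := hr1
  rw [hS3] at hr2
  have hc0 : (M.L x ∩ M.L y).card = 0 := by rw [hc]; rfl
  by_cases ha : (M.A x ∩ M.A y).card = 0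
  · right
    rw [if_neg (by simpa using ha)] at hr2
    obtain ⟨h5m, h5s⟩ := createClique_spec x y s₄ (by rw [h4m]; exact hNx) (by rw [h4m]; exact hNy)
    rw [← hr2, h4m] at h5m h5s
    refine ⟨hc, Finset.card_eq_zero.mp ha, h5m, ?_⟩
    change r.steps ≤ s₄.steps + 14 + 5 * min (M.N x).card (M.N y).card at h5s
    omega
  · left
    rw [if_pos ha] at hr2
    have hr3 : r = (extendClique (pick s₄.steps s₄.mem.S) x y (select pick vS s₄).2).2 := hr2
    obtain ⟨h5m, h5s⟩ := extendClique_spec (pick s₄.steps s₄.mem.S) x y (select pick vS s₄).2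
    rw [← hr3] at h5m h5s
    have h6m : (select pick vS s₄).2.mem = M₂ := h4m
    have h6s : (select pick vS s₄).2.steps = s₄.steps + 1 := rfl
    rw [h6m] at h5m h5s
    refine ⟨hc, pick s₄.steps s₄.mem.S, ?_, h5m, ?_⟩
    · have : s₄.mem.S = M.A x ∩ M.A y := by rw [h4m]
      rw [this]
      exact hpick _ _ (Finset.card_pos.mp (by omega))
    · change r.steps ≤ _ + M.X.card + 5 + 8 * (M.D (pick s₄.steps s₄.mem.S)).card at h5s
      omega

end Algorithm

/-! ### The invariant of the main loop -/

section Invariant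

variable {V : Type u} [Fintype V]

/-- The invariant once the edges in `E` have been treated. The function `orig` sends a label to the
edge for which it was introduced. -/
structure Invariant (G : SimpleGraph V) [DecidableRel G.Adj] (E : Finset (Sym2 V)) (M : Memory V)
    (orig : ℕ → Sym2 V) : Prop where
  N_eq : ∀ v, M.N v = G.neighborFinset v
  isClique : ∀ ℓ < M.k, G.IsClique (M.C ℓ : Set V)
  /-- `D ℓ` is the common closed neighbourhood of the members of `C ℓ`. -/
  mem_D : ∀ ℓ < M.k, ∀ w, w ∈ M.D ℓ ↔ ∀ c ∈ M.C ℓ, w = c ∨ G.Adj w c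
  mem_L : ∀ v ℓ, ℓ ∈ M.L v ↔ ℓ < M.k ∧ v ∈ M.C ℓ
  mem_A : ∀ v ℓ, ℓ ∈ M.A v ↔ ℓ < M.k ∧ v ∈ M.D ℓ
  covered : ∀ x y, s(x, y) ∈ E → ∃ ℓ < M.k, x ∈ M.C ℓ ∧ y ∈ M.C ℓ
  /-- No two cliques have a union that is a clique. -/
  minimal : ∀ ℓ < M.k, ∀ ℓ' < M.k, ℓ ≠ ℓ' →
    ∃ a ∈ M.C ℓ, ∃ b ∈ M.C ℓ', a ≠ b ∧ ¬ G.Adj a b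
  S_subset : M.S ⊆ Finset.range M.k
  orig_mem : ∀ ℓ < M.k, orig ℓ ∈ E
  mem_C_of_mem_orig : ∀ ℓ < M.k, ∀ v ∈ orig ℓ, v ∈ M.C ℓ
  orig_injOn : Set.InjOn orig (Finset.range M.k)
  sum_card_C_le : ∑ ℓ ∈ Finset.range M.k, (M.C ℓ).card ≤ 2 * E.card

variable {G : SimpleGraph V} [DecidableRel G.Adj] {E : Finset (Sym2 V)} {M : Memory V}
  {orig : ℕ → Sym2 V}

theorem Invariant.set_S (h : Invariant G E M orig) {T : Finset ℕ} (hT : T ⊆ Finset.range M.k) :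
    Invariant G E { M with S := T } orig :=
  { h with S_subset := hT }

theorem Invariant.card_A_le_k (h : Invariant G E M orig) (x : V) : (M.A x).card ≤ M.k := by
  refine (Finset.card_le_card (t := Finset.range M.k) fun ℓ hℓ => ?_).trans (by simp)
  simpa using ((h.mem_A x ℓ).mp hℓ).1

theorem Invariant.card_S_le (h : Invariant G E M orig) : M.S.card ≤ M.k :=
  (Finset.card_le_card h.S_subset).trans (by simp)

variable [DecidableEq V]

theorem Invariant.insert_of_covered (h : Invariant G E M orig) {x y : V}
    (hxy : (M.L x ∩ M.L y).Nonempty) : Invariant G (Insert.insert s(x, y) E) M orig :=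
  { h with
    covered := by
      intro a b hab
      obtain ⟨ℓ, hℓ⟩ := hxy
      rw [Finset.mem_inter, h.mem_L, h.mem_L] at hℓ
      rcases Finset.mem_insert.mp hab with hab | hab
      · rcases Sym2.eq_iff.mp hab with ⟨rfl, rfl⟩ | ⟨rfl, rfl⟩
        · exact ⟨ℓ, hℓ.1.1, hℓ.1.2, hℓ.2.2⟩
        · exact ⟨ℓ, hℓ.1.1, hℓ.2.2, hℓ.1.2⟩
      · exact h.covered a b hab
    orig_mem := fun ℓ hℓ => Finset.mem_insert_of_mem (h.orig_mem ℓ hℓ)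
    sum_card_C_le := h.sum_card_C_le.trans
      (Nat.mul_le_mul_left _ (Finset.card_le_card (Finset.subset_insert _ _))) }

theorem Invariant.C_subset_D (h : Invariant G E M orig) {ℓ : ℕ} (hℓ : ℓ < M.k) :
    M.C ℓ ⊆ M.D ℓ := by
  intro w hw
  rw [h.mem_D ℓ hℓ]
  intro c hc
  by_cases hwc : w = c
  · exact Or.inl hwc
  · exact Or.inr (h.isClique ℓ hℓ hw hc hwc)

/-- A vertex remains in `D ℓ` exactly if it is a member of the enlarged clique or is adjacent to
both of its new members, so `D ℓ` is again the common closed neighbourhood. -/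
theorem Invariant.extend (h : Invariant G E M orig) {x y : V} (hadj : G.Adj x y)
    (hE : s(x, y) ∉ E) {ℓ : ℕ} (hℓ : ℓ ∈ M.A x ∩ M.A y) :
    Invariant G (Insert.insert s(x, y) E) (extendMemory M ℓ x y) orig := by
  rw [Finset.mem_inter, h.mem_A, h.mem_A] at hℓ
  obtain ⟨⟨hk, hx⟩, -, hy⟩ := hℓ
  have hxC := (h.mem_D ℓ hk x).mp hx
  have hyC := (h.mem_D ℓ hk y).mp hy
  have hC : (extendMemory M ℓ x y).C ℓ = Insert.insert y (Insert.insert x (M.C ℓ)) :=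
    Function.update_self ..
  have hC' : ∀ j, j ≠ ℓ → (extendMemory M ℓ x y).C j = M.C j := fun j hj =>
    Function.update_of_ne hj ..
  have hD : (extendMemory M ℓ x y).D ℓ = M.D ℓ \ dropped M ℓ x y := Function.update_self ..
  have hD' : ∀ j, j ≠ ℓ → (extendMemory M ℓ x y).D j = M.D j := fun j hj =>
    Function.update_of_ne hj ..
  have hsub : ∀ j, M.C j ⊆ (extendMemory M ℓ x y).C j := by
    intro j
    by_cases hj : j = ℓ
    · subst hj
      rw [hC]
      exact (Finset.subset_insert _ _).trans (Finset.subset_insert _ _)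
    · rw [hC' j hj]
  have hclique : G.IsClique ((Insert.insert y (Insert.insert x (M.C ℓ)) : Finset V) : Set V) := by
    rw [Finset.coe_insert, Finset.coe_insert]
    refine ((h.isClique ℓ hk).insert fun c hc hxc => (hxC c hc).resolve_left hxc).insert ?_
    rintro c (rfl | hc) hyc
    · exact hadj.symm
    · exact (hyC c hc).resolve_left hyc
  have hdrop : ∀ w, w ∈ dropped M ℓ x y ↔ w ∈ M.D ℓ ∧
      w ∉ Insert.insert y (Insert.insert x (M.C ℓ)) ∧ ¬ (G.Adj x w ∧ G.Adj y w) := by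
    intro w
    simp only [dropped, Finset.mem_filter, h.N_eq, SimpleGraph.mem_neighborFinset]
  refine
    { N_eq := h.N_eq, isClique := ?_, mem_D := ?_, mem_L := ?_, mem_A := ?_, covered := ?_,
      minimal := ?_, S_subset := h.S_subset, orig_mem := ?_, mem_C_of_mem_orig := ?_,
      orig_injOn := h.orig_injOn, sum_card_C_le := ?_ }
  · intro j hj
    by_cases hjl : j = ℓ
    · subst hjl; rw [hC]; exact hclique
    · rw [hC' j hjl]; exact h.isClique j hj
  · intro j hj w
    by_cases hjl : j = ℓ
    swap
    · rw [hC' j hjl, hD' j hjl]; exact h.mem_D j hj w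
    subst hjl
    rw [hC, hD, Finset.mem_sdiff, hdrop, h.mem_D j hj]
    constructor
    · rintro ⟨hw, hnd⟩ c hc
      by_cases hwC : w ∈ Insert.insert y (Insert.insert x (M.C j))
      · by_cases hwc : w = c
        · exact Or.inl hwc
        · exact Or.inr (hclique hwC hc hwc)
      · have hxy : G.Adj x w ∧ G.Adj y w := by
          by_contra hne
          exact hnd ⟨hw, hwC, hne⟩
        rw [Finset.mem_insert, Finset.mem_insert] at hc
        rcases hc with rfl | rfl | hc
        · exact Or.inr hxy.2.symm
        · exact Or.inr hxy.1.symm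
        · exact hw c hc
    · intro hw
      refine ⟨fun c hc => hw c (by simp [hc]), ?_⟩
      rintro ⟨-, hwC, hne⟩
      rw [Finset.mem_insert, Finset.mem_insert, not_or, not_or] at hwC
      exact hne ⟨((hw x (by simp)).resolve_left hwC.2.1).symm,
        ((hw y (by simp)).resolve_left hwC.1).symm⟩
  · intro v j
    change j ∈ (if v = x ∨ v = y then Insert.insert ℓ (M.L v) else M.L v) ↔ j < M.k ∧ _
    have key : j ∈ (if v = x ∨ v = y then Insert.insert ℓ (M.L v) else M.L v) ↔
        j ∈ M.L v ∨ (j = ℓ ∧ (v = x ∨ v = y)) := by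
      split_ifs with hv
      · rw [Finset.mem_insert]; tauto
      · tauto
    rw [key, h.mem_L]
    by_cases hjl : j = ℓ
    · subst hjl
      rw [hC, Finset.mem_insert, Finset.mem_insert]
      tauto
    · rw [hC' j hjl]
      tauto
  · intro v j
    change j ∈ (if v ∈ dropped M ℓ x y then (M.A v).erase ℓ else M.A v) ↔ j < M.k ∧ _
    have key : j ∈ (if v ∈ dropped M ℓ x y then (M.A v).erase ℓ else M.A v) ↔
        j ∈ M.A v ∧ ¬ (j = ℓ ∧ v ∈ dropped M ℓ x y) := by
      split_ifs with hv
      · rw [Finset.mem_erase]; tauto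
      · tauto
    rw [key, h.mem_A]
    by_cases hjl : j = ℓ
    · subst hjl
      rw [hD, Finset.mem_sdiff]
      tauto
    · rw [hD' j hjl]
      tauto
  · intro a b hab
    rcases Finset.mem_insert.mp hab with hab | hab
    · refine ⟨ℓ, hk, ?_⟩
      rw [hC]
      rcases Sym2.eq_iff.mp hab with ⟨rfl, rfl⟩ | ⟨rfl, rfl⟩ <;> simp
    · obtain ⟨j, hj, ha, hb⟩ := h.covered a b hab
      exact ⟨j, hj, hsub j ha, hsub j hb⟩
  · intro i hi j hj hij
    obtain ⟨a, ha, b, hb, hab⟩ := h.minimal i hi j hj hij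
    exact ⟨a, hsub i ha, b, hsub j hb, hab⟩
  · exact fun j hj => Finset.mem_insert_of_mem (h.orig_mem j hj)
  · exact fun j hj v hv => hsub j (h.mem_C_of_mem_orig j hj v hv)
  · rw [Finset.card_insert_of_notMem hE]
    have hk' := Finset.mem_range.mpr hk
    have e := h.sum_card_C_le
    change ∑ j ∈ Finset.range M.k, _ ≤ _
    rw [← Finset.add_sum_erase _ _ hk'] at e ⊢
    rw [hC, Finset.sum_congr rfl (g := fun j => (M.C j).card) fun j hj => by
      rw [hC' j (Finset.ne_of_mem_erase hj)]]
    have := Finset.card_insert_le y (Insert.insert x (M.C ℓ))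
    have := Finset.card_insert_le x (M.C ℓ)
    omega

/-- The only new instance of minimality is the new clique against an older one; it holds as no
older `D ℓ` contains both endpoints of the edge. -/
theorem Invariant.create (h : Invariant G E M orig) {x y : V} (hadj : G.Adj x y)
    (hE : s(x, y) ∉ E) (hA : M.A x ∩ M.A y = ∅) :
    Invariant G (Insert.insert s(x, y) E) (createMemory M x y)
      (Function.update orig M.k s(x, y)) := by
  have hC : (createMemory M x y).C M.k = {x, y} := Function.update_self ..
  have hC' : ∀ j, j ≠ M.k → (createMemory M x y).C j = M.C j := fun j hj =>
    Function.update_of_ne hj ..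
  set D' := Insert.insert y (Insert.insert x (M.N x ∩ M.N y)) with hD'
  have hD : (createMemory M x y).D M.k = D' := Function.update_self ..
  have hDo : ∀ j, j ≠ M.k → (createMemory M x y).D j = M.D j := fun j hj =>
    Function.update_of_ne hj ..
  have hlt : ∀ j, j < (createMemory M x y).k ↔ j < M.k ∨ j = M.k := fun j => by
    change j < M.k + 1 ↔ _
    omega
  -- some endpoint of the edge lies outside `D j`, so it has a non-neighbour in `C j`
  have hnew : ∀ j < M.k, ∃ a ∈ M.C j, ∃ b ∈ ({x, y} : Finset V), a ≠ b ∧ ¬ G.Adj a b := by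
    intro j hj
    by_contra! hne
    have : j ∈ M.A x ∩ M.A y := by
      rw [Finset.mem_inter, h.mem_A, h.mem_A, h.mem_D j hj, h.mem_D j hj]
      refine ⟨⟨hj, fun c hc => ?_⟩, hj, fun c hc => ?_⟩
      · by_cases hxc : c = x
        · exact Or.inl hxc.symm
        · exact Or.inr (hne c hc x (by simp) hxc).symm
      · by_cases hyc : c = y
        · exact Or.inl hyc.symm
        · exact Or.inr (hne c hc y (by simp) hyc).symm
    rw [hA] at this
    simp at this
  have hne : x ≠ y := hadj.ne
  refine
    { N_eq := h.N_eq, isClique := ?_, mem_D := ?_, mem_L := ?_, mem_A := ?_, covered := ?_,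
      minimal := ?_, S_subset := ?_, orig_mem := ?_, mem_C_of_mem_orig := ?_,
      orig_injOn := ?_, sum_card_C_le := ?_ }
  · intro j hj
    rcases (hlt j).mp hj with hj | rfl
    · rw [hC' j hj.ne]; exact h.isClique j hj
    · rw [hC]
      simpa [SimpleGraph.isClique_pair] using fun _ => hadj
  · intro j hj w
    rcases (hlt j).mp hj with hj | rfl
    · rw [hC' j hj.ne, hDo j hj.ne]; exact h.mem_D j hj w
    · rw [hC, hD]
      simp only [hD', Finset.mem_insert, Finset.mem_inter, h.N_eq, SimpleGraph.mem_neighborFinset,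
        Finset.mem_singleton, forall_eq_or_imp, forall_eq]
      constructor
      · rintro (rfl | rfl | hw)
        · exact ⟨Or.inr hadj.symm, Or.inl rfl⟩
        · exact ⟨Or.inl rfl, Or.inr hadj⟩
        · exact ⟨Or.inr hw.1.symm, Or.inr hw.2.symm⟩
      · rintro ⟨rfl | h1, rfl | h2⟩
        · exact Or.inl rfl
        · exact Or.inr (Or.inl rfl)
        · exact Or.inl rfl
        · exact Or.inr (Or.inr ⟨h1.symm, h2.symm⟩)
  · intro v j
    have key : j ∈ (createMemory M x y).L v ↔ j ∈ M.L v ∨ (j = M.k ∧ (v = x ∨ v = y)) := by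
      change j ∈ (if v = x ∨ v = y then Insert.insert M.k (M.L v) else M.L v) ↔ _
      split_ifs with hv
      · rw [Finset.mem_insert]; tauto
      · tauto
    rw [key, h.mem_L, hlt]
    by_cases hjk : j = M.k
    · subst hjk
      rw [hC, Finset.mem_insert, Finset.mem_singleton]
      simp
    · rw [hC' j hjk]
      tauto
  · intro v j
    have key : j ∈ (createMemory M x y).A v ↔ j ∈ M.A v ∨ (j = M.k ∧ v ∈ D') := by
      change j ∈ (if v ∈ D' then Insert.insert M.k (M.A v) else M.A v) ↔ _
      split_ifs with hv
      · rw [Finset.mem_insert]; tauto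
      · tauto
    rw [key, h.mem_A, hlt]
    by_cases hjk : j = M.k
    · subst hjk
      rw [hD]
      simp
    · rw [hDo j hjk]
      tauto
  · intro a b hab
    rcases Finset.mem_insert.mp hab with hab | hab
    · refine ⟨M.k, Nat.lt_succ_self _, ?_⟩
      rw [hC]
      rcases Sym2.eq_iff.mp hab with ⟨rfl, rfl⟩ | ⟨rfl, rfl⟩ <;> simp
    · obtain ⟨j, hj, hab⟩ := h.covered a b hab
      refine ⟨j, hj.trans (Nat.lt_succ_self _), ?_⟩
      rwa [hC' j hj.ne]
  · intro i hi j hj hij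
    rcases (hlt i).mp hi with hi | rfl <;> rcases (hlt j).mp hj with hj | rfl
    · rw [hC' i hi.ne, hC' j hj.ne]
      exact h.minimal i hi j hj hij
    · rw [hC' i hi.ne, hC]
      exact hnew i hi
    · rw [hC' j hj.ne, hC]
      obtain ⟨a, ha, b, hb, hab, hn⟩ := hnew j hj
      exact ⟨b, hb, a, ha, hab.symm, fun hba => hn hba.symm⟩
    · exact absurd rfl hij
  · exact h.S_subset.trans (Finset.range_mono (Nat.le_succ _))
  · intro j hj
    rcases (hlt j).mp hj with hj | rfl
    · rw [Function.update_of_ne hj.ne]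
      exact Finset.mem_insert_of_mem (h.orig_mem j hj)
    · rw [Function.update_self]
      exact Finset.mem_insert_self _ _
  · intro j hj v hv
    rcases (hlt j).mp hj with hj | rfl
    · rw [Function.update_of_ne hj.ne] at hv
      rw [hC' j hj.ne]
      exact h.mem_C_of_mem_orig j hj v hv
    · rw [Function.update_self, Sym2.mem_iff] at hv
      rw [hC]
      simpa using hv
  · intro i hi j hj hij
    rw [Finset.mem_coe, Finset.mem_range] at hi hj
    rcases (hlt i).mp hi with hi | rfl <;> rcases (hlt j).mp hj with hj | rfl
    · rw [Function.update_of_ne hi.ne, Function.update_of_ne hj.ne] at hij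
      exact h.orig_injOn (by simpa using hi) (by simpa using hj) hij
    · rw [Function.update_of_ne hi.ne, Function.update_self] at hij
      exact absurd (hij ▸ h.orig_mem i hi) hE
    · rw [Function.update_of_ne hj.ne, Function.update_self] at hij
      exact absurd (hij ▸ h.orig_mem j hj) hE
    · rfl
  · rw [Finset.card_insert_of_notMem hE]
    change ∑ j ∈ Finset.range (M.k + 1), _ ≤ _
    rw [Finset.sum_range_succ, hC, Finset.card_pair hne,
      Finset.sum_congr rfl (g := fun j => (M.C j).card) fun j hj => by
        rw [hC' j (Finset.mem_range.mp hj).ne]]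
    have := h.sum_card_C_le
    omega

/-! ### Sizes of the stored sets -/

theorem Invariant.card_D_le (h : Invariant G E M orig) {ℓ : ℕ} (hℓ : ℓ < M.k) :
    (M.D ℓ).card ≤ minDeg G (orig ℓ) + 1 := by
  have hD : ∀ c ∈ M.C ℓ, (M.D ℓ).card ≤ G.degree c + 1 := by
    intro c hc
    refine le_trans (Finset.card_le_card (t := Insert.insert c (G.neighborFinset c)) ?_)
      (Finset.card_insert_le _ _)
    intro w hw
    rw [Finset.mem_insert, SimpleGraph.mem_neighborFinset]
    exact ((h.mem_D ℓ hℓ w).mp hw c hc).imp_right SimpleGraph.Adj.symm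
  have hC := h.mem_C_of_mem_orig ℓ hℓ
  generalize orig ℓ = e at hC
  induction e with
  | _ u v =>
    have hu := hD u (hC u (by simp))
    have hv := hD v (hC v (by simp))
    change _ ≤ min (G.degree u) (G.degree v) + 1
    omega

/-- The labels in `A x` correspond to distinct edges whose endpoints lie in the closed neighbourhood
of `x`. -/
theorem Invariant.card_A_le (h : Invariant G E M orig) (hE : E ⊆ G.edgeFinset) (x : V) :
    (M.A x).card ≤ (degeneracy G + 1) * G.degree x := by
  have hinj : Set.InjOn orig (M.A x) := fun i hi j hj hij => by
    have hi' := ((h.mem_A x i).mp hi).1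
    have hj' := ((h.mem_A x j).mp hj).1
    exact h.orig_injOn (by simpa using hi') (by simpa using hj') hij
  rw [← Finset.card_image_of_injOn hinj]
  refine card_edges_closed_neighborhood_le G x _ ?_ ?_
  · intro e he
    obtain ⟨ℓ, hℓ, rfl⟩ := Finset.mem_image.mp he
    exact hE (h.orig_mem ℓ ((h.mem_A x ℓ).mp hℓ).1)
  · intro e he v hv
    obtain ⟨ℓ, hℓ, rfl⟩ := Finset.mem_image.mp he
    obtain ⟨hk, hx⟩ := (h.mem_A x ℓ).mp hℓ
    exact (h.mem_D ℓ hk x).mp hx v (h.mem_C_of_mem_orig ℓ hk v hv)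

theorem Invariant.L_subset_A (h : Invariant G E M orig) (x : V) : M.L x ⊆ M.A x := by
  intro ℓ hℓ
  rw [h.mem_L] at hℓ
  rw [h.mem_A]
  exact ⟨hℓ.1, h.C_subset_D hℓ.1 hℓ.2⟩

theorem Invariant.k_le (h : Invariant G E M orig) : M.k ≤ E.card := by
  rw [← Finset.card_range M.k, ← Finset.card_image_of_injOn h.orig_injOn]
  refine Finset.card_le_card fun e he => ?_
  obtain ⟨ℓ, hℓ, rfl⟩ := Finset.mem_image.mp he
  exact h.orig_mem ℓ (Finset.mem_range.mp hℓ)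

theorem Invariant.sum_minDeg_orig_le (h : Invariant G E M orig) (hE : E ⊆ G.edgeFinset) :
    ∑ ℓ ∈ Finset.range M.k, (minDeg G (orig ℓ) + 1) ≤
      2 * degeneracy G * G.edgeFinset.card + G.edgeFinset.card := by
  rw [← Finset.sum_image (f := fun e => minDeg G e + 1) h.orig_injOn]
  refine (Finset.sum_le_sum_of_subset (t := G.edgeFinset) fun e he => ?_).trans ?_
  · obtain ⟨ℓ, hℓ, rfl⟩ := Finset.mem_image.mp he
    exact hE (h.orig_mem ℓ (Finset.mem_range.mp hℓ))
  · rw [Finset.sum_add_distrib]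
    simpa using sum_minDeg_le G

theorem Invariant.words_le (h : Invariant G E M orig) [Nonempty V] :
    M.words ≤ 19 * ((M.k + 1) * Fintype.card V) := by
  have h1 : ∑ x, ((M.L x).card + 1 + ((M.A x).card + 1)) ≤
      Fintype.card V * (2 * M.k + 2) := by
    refine (Finset.sum_le_card_nsmul _ _ (2 * M.k + 2) fun x _ => ?_).trans (by simp)
    have := Finset.card_le_card (h.L_subset_A x)
    have := h.card_A_le_k x
    omega
  have h2 : ∑ ℓ ∈ Finset.range M.k, ((M.C ℓ).card + 1 + ((M.D ℓ).card + 1)) ≤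
      M.k * (2 * Fintype.card V + 2) := by
    refine (Finset.sum_le_card_nsmul _ _ (2 * Fintype.card V + 2) fun ℓ _ => ?_).trans (by simp)
    have := Finset.card_le_univ (M.C ℓ)
    have := Finset.card_le_univ (M.D ℓ)
    omega
  have h3 := h.card_S_le
  have h4 := Finset.card_le_univ M.X
  have h5 : 1 ≤ Fintype.card V := Fintype.card_pos
  unfold Memory.words
  nlinarith [Nat.mul_le_mul_left M.k h5]

theorem Invariant.words_le_degeneracy (h : Invariant G E M orig) (hE : E ⊆ G.edgeFinset)
    (hd : 1 ≤ degeneracy G) (hm : 1 ≤ G.edgeFinset.card)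
    (hn : Fintype.card V ≤ 2 * G.edgeFinset.card) :
    M.words ≤ 39 * (degeneracy G * G.edgeFinset.card) := by
  set d := degeneracy G
  set m := G.edgeFinset.card
  have h1 : ∑ x, ((M.L x).card + 1 + ((M.A x).card + 1)) ≤
      2 * ((d + 1) * (2 * m)) + 2 * Fintype.card V := by
    have : ∑ x, ((M.L x).card + 1 + ((M.A x).card + 1)) ≤
        ∑ x, (2 * ((d + 1) * G.degree x) + 2) := by
      refine Finset.sum_le_sum fun x _ => ?_
      have := Finset.card_le_card (h.L_subset_A x)
      have : (M.A x).card ≤ (d + 1) * G.degree x := h.card_A_le hE x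
      omega
    refine this.trans (le_of_eq ?_)
    rw [Finset.sum_add_distrib, ← Finset.mul_sum, ← Finset.mul_sum,
      G.sum_degrees_eq_twice_card_edges]
    simp [mul_comm, m]
  have h2 : ∑ ℓ ∈ Finset.range M.k, ((M.C ℓ).card + 1 + ((M.D ℓ).card + 1)) ≤
      2 * (2 * d * m + m) + 2 * M.k := by
    have : ∑ ℓ ∈ Finset.range M.k, ((M.C ℓ).card + 1 + ((M.D ℓ).card + 1)) ≤
        ∑ ℓ ∈ Finset.range M.k, (2 * (minDeg G (orig ℓ) + 1) + 2) := by
      refine Finset.sum_le_sum fun ℓ hℓ => ?_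
      have := Finset.card_le_card (h.C_subset_D (Finset.mem_range.mp hℓ))
      have := h.card_D_le (Finset.mem_range.mp hℓ)
      omega
    refine this.trans ?_
    rw [Finset.sum_add_distrib, ← Finset.mul_sum]
    have : ∑ ℓ ∈ Finset.range M.k, (minDeg G (orig ℓ) + 1) ≤ 2 * d * m + m :=
      h.sum_minDeg_orig_le hE
    simp only [Finset.sum_const, Finset.card_range, smul_eq_mul]
    omega
  have h3 := h.card_S_le
  have h4 := Finset.card_le_univ M.X
  have h5 : M.k ≤ m := h.k_le.trans (Finset.card_le_card hE)
  have h6 : m ≤ d * m := Nat.le_mul_of_pos_left _ hd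
  have h7 : 2 * ((d + 1) * (2 * m)) = 4 * (d * m) + 4 * m := by ring
  have h8 : 2 * (2 * d * m + m) = 4 * (d * m) + 2 * m := by ring
  unfold Memory.words
  omega

end Invariant

/-! ### Costs of the main loop -/

section Costs

variable {V : Type u} [Fintype V]

theorem two_mul_card_edgeFinset_le (G : SimpleGraph V) [DecidableRel G.Adj] :
    2 * G.edgeFinset.card ≤ Fintype.card V ^ 2 := by
  rw [← G.sum_degrees_eq_twice_card_edges, pow_two]
  exact (Finset.sum_le_card_nsmul _ _ (Fintype.card V) fun x _ =>
    (G.degree_lt_card_verts x).le).trans (by simp)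

theorem card_le_two_mul_card_edgeFinset (G : SimpleGraph V) [DecidableRel G.Adj]
    (hG : ∀ x, ∃ y, G.Adj x y) : Fintype.card V ≤ 2 * G.edgeFinset.card := by
  rw [← G.sum_degrees_eq_twice_card_edges, ← Finset.card_univ, Finset.card_eq_sum_ones]
  exact Finset.sum_le_sum fun x _ => (G.degree_pos_iff_exists_adj x).mpr (hG x)

/-- The share of the costs that is charged to the members of the cliques: each member of `C ℓ` pays
for one scan of `D ℓ`. -/
def memberCharge (G : SimpleGraph V) [DecidableRel G.Adj] (M : Memory V) (orig : ℕ → Sym2 V) : ℕ :=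
  ∑ ℓ ∈ Finset.range M.k, (M.C ℓ).card * (minDeg G (orig ℓ) + 1)

theorem memberCharge_le (G : SimpleGraph V) [DecidableRel G.Adj] (M : Memory V)
    (orig : ℕ → Sym2 V) :
    memberCharge G M orig ≤ M.k * Fintype.card V ^ 2 := by
  have hdeg : ∀ e, minDeg G e + 1 ≤ Fintype.card V := by
    intro e
    induction e with
    | _ a b =>
      have := G.degree_lt_card_verts a
      change min (G.degree a) (G.degree b) + 1 ≤ _
      omega
  refine (Finset.sum_le_card_nsmul _ _ (Fintype.card V ^ 2) fun ℓ _ => ?_).trans (by simp)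
  rw [pow_two]
  exact Nat.mul_le_mul (Finset.card_le_univ _) (hdeg _)

variable [DecidableEq V]

/-- The invariant of the main loop together with bounds on the counters. The scratch sets act as a
potential that pays for their next emptying. -/
structure Progress (G : SimpleGraph V) [DecidableRel G.Adj] (E : Finset (Sym2 V)) (s : Machine V)
    (orig : ℕ → Sym2 V) : Prop where
  inv : Invariant G E s.mem orig
  words_le_peak : s.mem.words ≤ s.peak
  steps_le : s.steps + s.mem.S.card + s.mem.X.card ≤ 3 * Fintype.card V + 31 * E.card +
    10 * min (E.card * s.mem.k) ((degeneracy G + 1) * ∑ e ∈ E, minDeg G e) +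
    9 * memberCharge G s.mem orig
  peak_le : s.peak ≤ 100 * ((s.mem.k + 1) * Fintype.card V)
  peak_le_degeneracy : s.peak ≤ 220 * (degeneracy G * G.edgeFinset.card)

variable {G : SimpleGraph V} [DecidableRel G.Adj] {E : Finset (Sym2 V)} {orig : ℕ → Sym2 V}

theorem Invariant.min_card_le {M : Memory V} (h : Invariant G E M orig) (hE : E ⊆ G.edgeFinset)
    (x y : V) :
    min (M.L x).card (M.L y).card ≤ min M.k ((degeneracy G + 1) * minDeg G s(x, y)) ∧
      min (M.A x).card (M.A y).card ≤ min M.k ((degeneracy G + 1) * minDeg G s(x, y)) := by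
  have h1 := Finset.card_le_card (h.L_subset_A x)
  have h2 := Finset.card_le_card (h.L_subset_A y)
  have h3 := h.card_A_le_k x
  have h4 := h.card_A_le hE x
  have h5 := h.card_A_le hE y
  have h6 : (degeneracy G + 1) * minDeg G s(x, y) =
      min ((degeneracy G + 1) * G.degree x) ((degeneracy G + 1) * G.degree y) :=
    Nat.mul_min_mul_left _ _ _ |>.symm
  rw [h6]
  omega

/-- When the uncovered edge `{x, y}` joins `C ℓ`, at least one of `x`, `y` is a new member, and pays
for the scan of `D ℓ`. -/
theorem memberCharge_extendMemory {M : Memory V} (h : Invariant G E M orig) {x y : V} {ℓ : ℕ}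
    (hL : M.L x ∩ M.L y = ∅) (hℓ : ℓ < M.k) :
    memberCharge G M orig + (M.D ℓ).card ≤ memberCharge G (extendMemory M ℓ x y) orig := by
  have hC : (extendMemory M ℓ x y).C ℓ = Insert.insert y (Insert.insert x (M.C ℓ)) :=
    Function.update_self ..
  have hcard : (M.C ℓ).card + 1 ≤ ((extendMemory M ℓ x y).C ℓ).card := by
    rw [hC]
    have hnot : ¬ (x ∈ M.C ℓ ∧ y ∈ M.C ℓ) := fun hxy => by
      have : ℓ ∈ M.L x ∩ M.L y := by
        rw [Finset.mem_inter, h.mem_L, h.mem_L]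
        exact ⟨⟨hℓ, hxy.1⟩, hℓ, hxy.2⟩
      simp [hL] at this
    refine Finset.card_lt_card (Finset.ssubset_iff_of_subset ?_ |>.mpr ?_)
    · exact (Finset.subset_insert _ _).trans (Finset.subset_insert _ _)
    · by_cases hx : x ∈ M.C ℓ
      · exact ⟨y, by simp, fun hy => hnot ⟨hx, hy⟩⟩
      · exact ⟨x, by simp, hx⟩
  have hD := h.card_D_le hℓ
  have hmem := Finset.mem_range.mpr hℓ
  change ∑ j ∈ Finset.range M.k, _ + _ ≤ ∑ j ∈ Finset.range M.k, _
  rw [← Finset.add_sum_erase _ _ hmem, ← Finset.add_sum_erase (Finset.range M.k)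
    (fun j => ((extendMemory M ℓ x y).C j).card * _) hmem]
  rw [Finset.sum_congr rfl (g := fun j => (M.C j).card * (minDeg G (orig j) + 1))
    (s₁ := (Finset.range M.k).erase ℓ)
    (f := fun j => ((extendMemory M ℓ x y).C j).card * (minDeg G (orig j) + 1)) fun j hj => by
      have : (extendMemory M ℓ x y).C j = M.C j :=
        Function.update_of_ne (Finset.ne_of_mem_erase hj) ..
      simp only [this]]
  have := Nat.mul_le_mul_right (minDeg G (orig ℓ) + 1) hcard
  rw [Nat.add_mul, Nat.one_mul] at this
  omega

theorem memberCharge_createMemory {M : Memory V} {x y : V} (hne : x ≠ y) :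
    memberCharge G (createMemory M x y) (Function.update orig M.k s(x, y)) =
      memberCharge G M orig + 2 * (minDeg G s(x, y) + 1) := by
  have hC : (createMemory M x y).C M.k = {x, y} := Function.update_self ..
  change ∑ j ∈ Finset.range (M.k + 1), _ = _
  rw [Finset.sum_range_succ, hC, Finset.card_pair hne, Function.update_self]
  congr 1
  refine Finset.sum_congr rfl fun j hj => ?_
  have hj := (Finset.mem_range.mp hj).ne
  have : (createMemory M x y).C j = M.C j := Function.update_of_ne hj ..
  rw [this, Function.update_of_ne hj]

/-- A clique has at most `d + 1` members, and the labels stem from distinct edges. -/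
theorem memberCharge_le_degeneracy {M : Memory V} (h : Invariant G E M orig)
    (hE : E ⊆ G.edgeFinset) :
    memberCharge G M orig ≤ (degeneracy G + 1) *
      (2 * degeneracy G * G.edgeFinset.card + G.edgeFinset.card) := by
  refine le_trans ?_ (Nat.mul_le_mul_left _ (h.sum_minDeg_orig_le hE))
  rw [Finset.mul_sum]
  exact Finset.sum_le_sum fun ℓ hℓ => Nat.mul_le_mul_right _
    (card_le_degeneracy_add_one G (h.isClique ℓ (Finset.mem_range.mp hℓ)))

/-- One iteration of the main loop, including the step that fetches the edge. -/
theorem Progress.processEdge [Nonempty V] {s : Machine V} (h : Progress G E s orig)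
    (hE : E ⊆ G.edgeFinset) {x y : V} (hadj : G.Adj x y) (hxy : s(x, y) ∉ E)
    (hn : Fintype.card V ≤ 2 * G.edgeFinset.card)
    (pick : ℕ → Finset ℕ → ℕ) (hpick : ∀ t S, S.Nonempty → pick t S ∈ S) :
    ∃ orig', Progress G (Insert.insert s(x, y) E) (processEdge pick x y (exec 1 1 id s).2).2 orig' := by
  have hd := degeneracy_pos G hadj
  have hm : 1 ≤ G.edgeFinset.card := Finset.card_pos.mpr ⟨s(x, y), by simpa using hadj⟩
  have hn1 : 1 ≤ Fintype.card V := Fintype.card_pos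
  obtain ⟨inv, hwp, hsteps, hpeak, hpeak'⟩ := h
  have hspec := processEdge_spec pick hpick x y (exec 1 1 id s).2
    (by simpa [inv.N_eq] using hadj : y ∈ s.mem.N x)
    (by simpa [inv.N_eq] using hadj.symm : x ∈ s.mem.N y)
  have hq : Acc s (exec 1 1 id s).2 :=
    Acc.exec (by simp) (by simpa using one_le_opCost s.peak)
  have hacc := hq.trans (tame_processEdge pick x y _ hq.words_le_peak)
  have hmin := inv.min_card_le hE x y
  have hSk := inv.card_S_le
  have hXn := Finset.card_le_univ s.mem.X
  have hkm : s.mem.k ≤ G.edgeFinset.card := inv.k_le.trans (Finset.card_le_card hE)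
  have hw := inv.words_le
  have hw' := inv.words_le_degeneracy hE hd hm hn
  have hLsub : s.mem.L x ∩ s.mem.L y ⊆ Finset.range s.mem.k := fun ℓ hℓ =>
    Finset.mem_range.mpr ((inv.mem_L x ℓ).mp (Finset.mem_inter.mp hℓ).1).1
  have hAsub : s.mem.A x ∩ s.mem.A y ⊆ Finset.range s.mem.k := fun ℓ hℓ =>
    Finset.mem_range.mpr ((inv.mem_A x ℓ).mp (Finset.mem_inter.mp hℓ).1).1
  have hLc : (s.mem.L x ∩ s.mem.L y).card ≤ min (s.mem.L x).card (s.mem.L y).card :=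
    le_min (Finset.card_le_card Finset.inter_subset_left)
      (Finset.card_le_card Finset.inter_subset_right)
  have hAc : (s.mem.A x ∩ s.mem.A y).card ≤ min (s.mem.A x).card (s.mem.A y).card :=
    le_min (Finset.card_le_card Finset.inter_subset_left)
      (Finset.card_le_card Finset.inter_subset_right)
  have hNx : min (s.mem.N x).card (s.mem.N y).card = minDeg G s(x, y) := by
    rw [inv.N_eq, inv.N_eq]; rfl
  have hNn : minDeg G s(x, y) ≤ Fintype.card V :=
    (min_le_left _ _).trans (G.degree_lt_card_verts x).le
  have hqs : (exec 1 1 id s).2.steps = s.steps + 1 := rfl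
  have hqm : (exec 1 1 id s).2.mem = s.mem := rfl
  rw [hqs, hqm] at hspec
  set r := (GlobalAdm.processEdge pick x y (exec 1 1 id s).2).2 with hr
  have hdm : G.edgeFinset.card ≤ degeneracy G * G.edgeFinset.card := Nat.le_mul_of_pos_left _ hd
  -- the bounds on space follow from a bound on the number of steps for this edge
  have key : ∀ orig', Invariant G (Insert.insert s(x, y) E) r.mem orig' → s.mem.k ≤ r.mem.k →
      r.steps ≤ s.steps + 9 * s.mem.k + 39 * Fintype.card V →
      r.steps + r.mem.S.card + r.mem.X.card + 9 * memberCharge G s.mem orig ≤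
        s.steps + s.mem.S.card + s.mem.X.card + 31 +
        5 * (min (s.mem.L x).card (s.mem.L y).card + min (s.mem.A x).card (s.mem.A y).card) +
        9 * memberCharge G r.mem orig' →
      Progress G (Insert.insert s(x, y) E) r orig' := by
    intro orig' hinv hk h1 h2
    clear hspec
    refine ⟨hinv, hacc.words_le_peak, ?_, ?_, ?_⟩
    · rw [Finset.card_insert_of_notMem hxy, Finset.sum_insert hxy,
        Nat.mul_add (degeneracy G + 1), Nat.add_mul E.card]
      have := Nat.mul_le_mul_left E.card hk
      omega
    · have e1 := hacc.peak_le
      have e2 := Nat.mul_le_mul_right (Fintype.card V) (Nat.add_le_add_right hk 1)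
      have e3 : (s.mem.k + 1) * Fintype.card V = s.mem.k * Fintype.card V + Fintype.card V := by
        ring
      have e4 : s.mem.k ≤ s.mem.k * Fintype.card V := Nat.le_mul_of_pos_right _ hn1
      omega
    · have e1 := hacc.peak_le
      omega
  rcases hspec with ⟨hL, hmem, hst⟩ | ⟨hL, ℓ, hℓ, hmem, hst⟩ | ⟨hL, hA, hmem, hst⟩
  · refine ⟨orig, key orig ?_ ?_ ?_ ?_⟩
    · rw [hmem]
      exact (inv.set_S hLsub).insert_of_covered hL
    · rw [hmem]
    · omega
    · have hS : r.mem.S = s.mem.L x ∩ s.mem.L y := by rw [hmem]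
      have hX : r.mem.X = s.mem.X := by rw [hmem]
      have hP : memberCharge G r.mem orig = memberCharge G s.mem orig := by rw [hmem]; rfl
      rw [hS, hX, hP]
      omega
  · have hlk : ℓ < s.mem.k := Finset.mem_range.mp (hAsub hℓ)
    have hDn := Finset.card_le_univ (s.mem.D ℓ)
    have inv₂ := inv.set_S hAsub
    have hP := memberCharge_extendMemory inv₂ (x := x) (y := y) (ℓ := ℓ) hL hlk
    change memberCharge G s.mem orig + (s.mem.D ℓ).card ≤ _ at hP
    rw [← hmem] at hP
    refine ⟨orig, key orig ?_ ?_ ?_ ?_⟩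
    · rw [hmem]
      exact inv₂.extend hadj hxy hℓ
    · rw [hmem]; exact le_rfl
    · omega
    · have hS : r.mem.S = s.mem.A x ∩ s.mem.A y := by rw [hmem]; rfl
      have hX : r.mem.X.card ≤ (s.mem.D ℓ).card := by
        rw [hmem]
        exact Finset.card_filter_le _ _
      rw [hS]
      omega
  · have inv₂ := inv.set_S hAsub
    have hP := memberCharge_createMemory (G := G) (orig := orig)
      (M := { s.mem with S := s.mem.A x ∩ s.mem.A y }) hadj.ne
    rw [← hmem] at hP
    change memberCharge G r.mem (Function.update orig s.mem.k s(x, y)) =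
      memberCharge G s.mem orig + _ at hP
    refine ⟨Function.update orig s.mem.k s(x, y), key _ ?_ ?_ ?_ ?_⟩
    · rw [hmem]
      exact inv₂.create hadj hxy hA
    · rw [hmem]; exact Nat.le_succ _
    · omega
    · have hS : r.mem.S = s.mem.A x ∩ s.mem.A y := by rw [hmem]; rfl
      have hX : r.mem.X = s.mem.X := by rw [hmem]; rfl
      rw [hS, hX]
      omega

theorem Progress.forList_processEdge [Nonempty V]
    (hn : Fintype.card V ≤ 2 * G.edgeFinset.card)
    (pick : ℕ → Finset ℕ → ℕ) (hpick : ∀ t S, S.Nonempty → pick t S ∈ S) (l : List (V × V))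
    {s : Machine V} (h : Progress G E s orig) (hE : E ⊆ G.edgeFinset)
    (hl : ∀ e ∈ l, G.Adj e.1 e.2 ∧ s(e.1, e.2) ∉ E) (hnd : (l.map fun e => s(e.1, e.2)).Nodup) :
    ∃ orig', Progress G (E ∪ (l.map fun e => s(e.1, e.2)).toFinset)
      (forList 1 (fun e => GlobalAdm.processEdge pick e.1 e.2) l s).2 orig' := by
  induction l generalizing s E orig with
  | nil =>
    refine ⟨orig, ?_⟩
    rw [List.map_nil, List.toFinset_nil, Finset.union_empty]
    exact h
  | cons e l ih =>
    obtain ⟨hadj, he⟩ := hl e (by simp)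
    obtain ⟨orig₁, h₁⟩ := h.processEdge hE hadj he hn pick hpick
    rw [List.map_cons, List.nodup_cons] at hnd
    obtain ⟨orig₂, h₂⟩ := ih h₁ (Finset.insert_subset (by simpa using hadj) hE)
      (fun e' he' => ⟨(hl e' (by simp [he'])).1, fun hmem => by
        rcases Finset.mem_insert.mp hmem with heq | hmem
        · exact hnd.1 (heq ▸ List.mem_map_of_mem he')
        · exact (hl e' (by simp [he'])).2 hmem⟩) hnd.2
    refine ⟨orig₂, ?_⟩
    rw [List.map_cons, List.toFinset_cons, Finset.union_insert, ← Finset.insert_union]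
    exact h₂

end Costs

/-! ### The whole run -/

section Run

theorem log_two_pow_three_le (n : ℕ) : Nat.log 2 (2 ^ 8 * n ^ 3) ≤ 3 * Nat.log 2 n + 10 := by
  have h : n ^ 3 < (2 ^ (Nat.log 2 n + 1)) ^ 3 :=
    Nat.pow_lt_pow_left (Nat.lt_pow_succ_log_self one_lt_two n) (by norm_num)
  refine Nat.lt_succ_iff.mp (Nat.log_lt_of_lt_pow' (by omega) ?_)
  calc 2 ^ 8 * n ^ 3 < 2 ^ 8 * (2 ^ (Nat.log 2 n + 1)) ^ 3 := by omega
    _ = 2 ^ (3 * Nat.log 2 n + 10 + 1) := by rw [← pow_mul, ← pow_add]; congr 1; ring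
variable {V : Type u} [Fintype V]

variable {G : SimpleGraph V} [DecidableRel G.Adj]

theorem words_inputMemory : (inputMemory G).words = 2 * Fintype.card V + 16 := by
  simp [Memory.words, inputMemory, mul_comm]

theorem invariant_inputMemory (orig : ℕ → Sym2 V) : Invariant G ∅ (inputMemory G) orig where
  N_eq _ := rfl
  isClique _ h := absurd h (Nat.not_lt_zero _)
  mem_D _ h := absurd h (Nat.not_lt_zero _)
  mem_L _ _ := by simp [inputMemory]
  mem_A _ _ := by simp [inputMemory]
  covered _ _ h := by simp at h
  minimal _ h := absurd h (Nat.not_lt_zero _)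
  S_subset := by simp [inputMemory]
  orig_mem _ h := absurd h (Nat.not_lt_zero _)
  mem_C_of_mem_orig _ h := absurd h (Nat.not_lt_zero _)
  orig_injOn := by simp [inputMemory]
  sum_card_C_le := by simp [inputMemory]

variable [DecidableEq V]

/-- The sets `A x` and `L x` are empty already, so the initialisation takes three steps for each
vertex and changes nothing. -/
theorem initialize_spec (l : List V) (s : Machine V) (hA : ∀ x, s.mem.A x = ∅)
    (hL : ∀ x, s.mem.L x = ∅) :
    (forList 1 (fun x => do clear (vA x); clear (vL x)) l s).2.mem = s.mem ∧
      (forList 1 (fun x => do clear (vA x); clear (vL x)) l s).2.steps = s.steps + 3 * l.length := by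
  induction l generalizing s with
  | nil => exact ⟨rfl, rfl⟩
  | cons x l ih =>
    set r : Machine V := (clear (vL x) (clear (vA x) (exec 1 1 id s).2).2).2 with hr
    have hm : r.mem = s.mem := by
      have : r.mem = { s.mem with
        A := Function.update s.mem.A x ∅
        L := Function.update s.mem.L x ∅ } := rfl
      rw [this, Function.update_eq_self_iff.mpr (hL x).symm,
        Function.update_eq_self_iff.mpr (hA x).symm]
    have hs : r.steps = s.steps + 3 := by
      have : r.steps = s.steps + 1 + ((s.mem.A x).card + 1) + ((s.mem.L x).card + 1) := rfl
      rw [this, hA, hL]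
      rfl
    obtain ⟨h1, h2⟩ := ih r (by rwa [hm]) (by rwa [hm])
    have e : forList 1 (fun x => do clear (vA x); clear (vL x)) (x :: l) s =
      forList 1 (fun x => do clear (vA x); clear (vL x)) l r := rfl
    rw [e, h1, h2, hm, hs, List.length_cons]
    exact ⟨rfl, by ring⟩

theorem tame_globalAdmissibility (pick : ℕ → Finset ℕ → ℕ) (edges : List (V × V)) :
    Tame (globalAdmissibility pick edges) := by
  have h₁ : ∀ x : V, Tame (do clear (vA x); clear (vL x)) := fun x =>
    (tame_clear (fits_vA x)).bind fun _ => tame_clear (fits_vL x)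
  have h₂ : ∀ e : V × V, Tame (processEdge pick e.1 e.2) := fun e => tame_processEdge pick e.1 e.2
  exact (tame_forList h₁ _).bind fun _ => tame_forList h₂ _

/-- The invariant and the bounds hold after the run, with all edges treated. -/
theorem exists_progress_finalMachine [Nonempty V] (hG : ∀ x, ∃ y, G.Adj x y)
    {edges : List (V × V)} (hedges : ListsEdges G edges)
    (pick : ℕ → Finset ℕ → ℕ) (hpick : ∀ t S, S.Nonempty → pick t S ∈ S) :
    ∃ orig, Progress G G.edgeFinset (finalMachine G pick edges) orig := by
  obtain ⟨x⟩ := ‹Nonempty V›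
  obtain ⟨y, hadj⟩ := hG x
  have : Nonempty V := ⟨x⟩
  have hd := degeneracy_pos G hadj
  have hn1 : 1 ≤ Fintype.card V := Fintype.card_pos
  have hn := card_le_two_mul_card_edgeFinset G hG
  have hdm : G.edgeFinset.card ≤ degeneracy G * G.edgeFinset.card := Nat.le_mul_of_pos_left _ hd
  set s₀ : Machine V := ⟨inputMemory G, 0, 0, (inputMemory G).words⟩ with hs₀
  set s₁ : Machine V := (forList 1 (fun x => do clear (vA x); clear (vL x))
    (Finset.univ : Finset V).toList s₀).2 with hs₁
  obtain ⟨hm, hs⟩ := initialize_spec (Finset.univ : Finset V).toList s₀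
    (fun _ => rfl) (fun _ => rfl)
  have hacc : Acc s₀ s₁ := tame_forList
    (fun x => (tame_clear (fits_vA x)).bind fun _ => tame_clear (fits_vL x)) _ s₀ le_rfl
  rw [← hs₁] at hm hs
  have hs' : s₁.steps = 3 * Fintype.card V := by
    rw [hs, Finset.length_toList, Finset.card_univ]
    exact Nat.zero_add _
  have hpeak : s₁.peak ≤ 8 * Fintype.card V + 16 := by
    have h1 := hacc.peak_le
    have h2 : s₀.mem.words = 2 * Fintype.card V + 16 := words_inputMemory
    have h3 : s₀.peak = 2 * Fintype.card V + 16 := words_inputMemory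
    have h4 : s₀.steps = 0 := rfl
    omega
  -- no label is in use yet, so the values of `orig` are irrelevant
  have hP : Progress G ∅ s₁ fun _ => s(x, x) := by
    refine ⟨by rw [hm]; exact invariant_inputMemory _, hacc.words_le_peak, ?_, ?_, by omega⟩
    · rw [hm, hs']
      have h1 : s₀.mem.S = ∅ := rfl
      have h2 : s₀.mem.X = ∅ := rfl
      rw [h1, h2]
      simp only [Finset.card_empty]
      omega
    · rw [hm]
      have : s₀.mem.k = 0 := rfl
      rw [this]
      omega
  obtain ⟨orig, h⟩ := hP.forList_processEdge hn pick hpick edges (Finset.empty_subset _)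
    (fun e he => ⟨(hedges.2 _).mp (List.mem_map_of_mem (f := fun e => s(e.1, e.2)) he), by simp⟩)
    hedges.1
  refine ⟨orig, ?_⟩
  have : (∅ : Finset (Sym2 V)) ∪ (edges.map fun e => s(e.1, e.2)).toFinset = G.edgeFinset := by
    ext e
    rw [Finset.empty_union, List.mem_toFinset, hedges.2, SimpleGraph.mem_edgeFinset]
  rw [this] at h
  exact h

/-- A union of two or more members that is a clique would contain a union of two members that is a
clique. -/
theorem Invariant.isSuccinctDCC {M : Memory V} {orig : ℕ → Sym2 V}
    (h : Invariant G G.edgeFinset M orig) : IsSuccinctDCC 2 G (output M) := by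
  refine ⟨⟨⟨fun ℓ hℓ => h.isClique ℓ (Finset.mem_range.mp hℓ), fun x y hxy => ?_⟩, fun v => ?_, ?_⟩,
    ?_, h.sum_card_C_le⟩
  · obtain ⟨ℓ, hℓ, hmem⟩ := h.covered x y (by simpa using hxy)
    exact ⟨ℓ, Finset.mem_range.mpr hℓ, hmem⟩
  · ext ℓ
    rw [Finset.mem_filter]
    change ℓ ∈ M.L v ↔ ℓ ∈ Finset.range M.k ∧ v ∈ M.C ℓ
    rw [h.mem_L, Finset.mem_range]
  · ext ℓ
    simp only [output, Finset.mem_biUnion, Finset.mem_univ, true_and, h.mem_L, Finset.mem_range]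
    refine ⟨fun ⟨v, hv⟩ => hv.1, fun hℓ => ?_⟩
    obtain ⟨v, hv⟩ : ∃ v, v ∈ orig ℓ := by
      induction orig ℓ with
      | _ a b => exact ⟨a, by simp⟩
    exact ⟨v, hℓ, h.mem_C_of_mem_orig ℓ hℓ v hv⟩
  · intro J hJ hJ2 hcl
    obtain ⟨i, hi, j, hj, hij⟩ := Finset.one_lt_card.mp hJ2
    obtain ⟨a, ha, b, hb, hab, hn⟩ := h.minimal i (Finset.mem_range.mp (hJ hi)) j
      (Finset.mem_range.mp (hJ hj)) hij
    exact hn (hcl (Set.mem_biUnion hi ha) (Set.mem_biUnion hj hb) hab)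

theorem IsSuccinctDCC.mono {K K' : ℕ} (hK : K ≤ K') {R : Rep V} (h : IsSuccinctDCC K G R) :
    IsSuccinctDCC K' G R :=
  ⟨h.1, h.2.1, h.2.2.trans (Nat.mul_le_mul_right _ hK)⟩

theorem steps_finalMachine_le [Nonempty V] {s : Machine V} {orig : ℕ → Sym2 V}
    (h : Progress G G.edgeFinset s orig) (hG : ∀ x, ∃ y, G.Adj x y) (hk : 1 ≤ s.mem.k) :
    s.steps ≤ 160 * min (s.mem.k * Fintype.card V ^ 2) (degeneracy G ^ 2 * G.edgeFinset.card) := by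
  obtain ⟨x⟩ := ‹Nonempty V›
  obtain ⟨y, hadj⟩ := hG x
  have : Nonempty V := ⟨x⟩
  have hd := degeneracy_pos G hadj
  have hn1 : 1 ≤ Fintype.card V := Fintype.card_pos
  have hn := card_le_two_mul_card_edgeFinset G hG
  have hm := two_mul_card_edgeFinset_le G
  have hsteps := h.steps_le
  have hP := memberCharge_le G s.mem orig
  have hP' := memberCharge_le_degeneracy h.inv subset_rfl
  have hsum := Nat.mul_le_mul_left (degeneracy G + 1) (sum_minDeg_le G)
  generalize memberCharge G s.mem orig = P at *
  generalize ∑ e ∈ G.edgeFinset, minDeg G e = Q at *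
  generalize G.edgeFinset.card = m at *
  generalize Fintype.card V = n at *
  generalize degeneracy G = d at *
  generalize s.mem.k = k at *
  have e1 : n ≤ n ^ 2 := Nat.le_self_pow (by norm_num) n
  have e2 : n ^ 2 ≤ k * n ^ 2 := Nat.le_mul_of_pos_left _ hk
  have e3 : m * k ≤ k * n ^ 2 := by
    rw [mul_comm]; exact Nat.mul_le_mul_left _ (by omega)
  have e4 : m ≤ d * m := Nat.le_mul_of_pos_left _ hd
  have e5 : d * m ≤ d ^ 2 * m := by
    rw [pow_two, mul_assoc]; exact Nat.le_mul_of_pos_left _ hd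
  have e6 : (d + 1) * (2 * d * m) = 2 * (d ^ 2 * m) + 2 * (d * m) := by ring
  have e7 : (d + 1) * (2 * d * m + m) = 2 * (d ^ 2 * m) + 3 * (d * m) + m := by ring
  omega

end Run

end GlobalAdm

theorem mainTheorem6 :
    ∃ K : ℕ, ∀ (V : Type*) [Fintype V] [DecidableEq V] [Nonempty V]
      (G : SimpleGraph V) [DecidableRel G.Adj],
      (∀ x, ∃ y, G.Adj x y) →
      ∀ edges : List (V × V), GlobalAdm.ListsEdges G edges →
      ∀ pick : ℕ → Finset ℕ → ℕ, (∀ t S, S.Nonempty → pick t S ∈ S) →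
        let n := Fintype.card V
        let m := G.edgeFinset.card
        let d := GlobalAdm.degeneracy G
        let F := GlobalAdm.finalMachine G pick edges
        let R := GlobalAdm.output F.mem
        let c := R.I.card
        GlobalAdm.IsSuccinctDCC K G R ∧
        F.steps ≤ K * min (c * n ^ 2) (d ^ 2 * m) ∧
        F.time ≤ K * min (c * n ^ 2) (d ^ 2 * m) * (Nat.log 2 n + 1) ∧
        F.peak ≤ K * min (c * n) (d * m) := by
  refine ⟨2000, fun V _ _ _ G _ hG edges hedges pick hpick => ?_⟩
  intro n m d F R c
  obtain ⟨orig, h⟩ := GlobalAdm.exists_progress_finalMachine hG hedges pick hpick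
  have hc : c = F.mem.k := Finset.card_range _
  have hk : 1 ≤ F.mem.k := by
    obtain ⟨x⟩ := ‹Nonempty V›
    obtain ⟨y, hxy⟩ := hG x
    obtain ⟨ℓ, hℓ, -⟩ := h.inv.covered x y (by simpa using hxy)
    exact Nat.lt_of_le_of_lt (Nat.zero_le _) hℓ
  have hsteps : F.steps ≤ 160 * min (c * n ^ 2) (d ^ 2 * m) := by
    rw [hc]; exact GlobalAdm.steps_finalMachine_le h hG hk
  have hpeak : F.peak ≤ 200 * (c * n) := by
    have h1 : F.peak ≤ 100 * ((F.mem.k + 1) * n) := h.peak_le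
    -- at least one label is in use, so `k + 1 ≤ 2 k`
    have h2 : (F.mem.k + 1) * n ≤ 2 * (F.mem.k * n) := by
      rw [← mul_assoc]
      exact Nat.mul_le_mul_right _ (by omega)
    rw [hc]
    omega
  refine ⟨h.inv.isSuccinctDCC.mono (by norm_num), by omega, ?_, ?_⟩
  · have hacc : GlobalAdm.Acc _ F := GlobalAdm.tame_globalAdmissibility pick edges
      ⟨GlobalAdm.inputMemory G, 0, 0, (GlobalAdm.inputMemory G).words⟩ le_rfl
    have htime : F.time ≤ F.steps * GlobalAdm.opCost F.peak := by simpa using hacc.time_le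
    have hcn : c ≤ n ^ 2 := by
      have h1 : F.mem.k ≤ m := h.inv.k_le
      have h2 : 2 * m ≤ n ^ 2 := GlobalAdm.two_mul_card_edgeFinset_le G
      omega
    -- all stored sets together have at most `256 * n ^ 3` elements
    have hcost : GlobalAdm.opCost F.peak ≤ 11 * (Nat.log 2 n + 1) := by
      have h1 : F.peak ≤ 2 ^ 8 * n ^ 3 := by
        have : c * n ≤ n ^ 3 := by
          rw [pow_succ]
          exact Nat.mul_le_mul_right _ hcn
        omega
      refine (GlobalAdm.opCost_mono h1).trans ?_
      have := GlobalAdm.log_two_pow_three_le n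
      unfold GlobalAdm.opCost
      omega
    refine (htime.trans (Nat.mul_le_mul hsteps hcost)).trans ?_
    rw [show 160 * min (c * n ^ 2) (d ^ 2 * m) * (11 * (Nat.log 2 n + 1)) =
      1760 * (min (c * n ^ 2) (d ^ 2 * m) * (Nat.log 2 n + 1)) by ring, mul_assoc]
    exact Nat.mul_le_mul_right _ (by norm_num)
  · have h1 : F.peak ≤ 220 * (d * m) := h.peak_le_degeneracy
    omega
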